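/- **Setting.** Let $d\ge 2$ and $r\in\{2,3,\dots,\infty\}$. A generalized interval exchange transformation (GIET) $T$ of class $C^r$ with $d$ intervals is a map of $[0,1]$ given by two partitions (up to endpoints) of $[0,1]$ into intervals $I^t_1,\dots,I^t_d$ and $I^b_1,\dots,I^b_d$, such that for each $i$ the restriction of $T$ to $I_i^t$ extends to an orientation preserving $C^r$-diffeomorphism of the closure of $I_i^t$ onto the closure of $I^b_i$. Its combinatorial datum is $\pi=(\pi_t,\pi_b)$, where $\pi_t(j)$ (resp. $\pi_b(j)$) is the label of the $j$-th interval from the left of the first (resp. second) partition; $\pi$ is irreducible if $\pi_t\{1,\dots,k\}\ne\pi_b\{1,\dots,k\}$ for $1\le k<d$. The shape log-slope vector of $T$ is $\omega(T)=\big(\log(|I_i^b|/|I_i^t|)\big)_{1\le i\le d}\in\mathbb R^d$, i.e. the vector of logarithms of the slopes of the affine interval exchange mapping each $I^t_i$ onto $I^b_i$. If the rightmost intervals $I^t_\alpha$, $\alpha=\pi_t(d)$, and $I^b_\beta$, $\beta=\pi_b(d)$, have different lengths, the Rauzy–Veech renormalization $\mathcal V(T)$ is the first return map of $T$ to $[0,1]$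 minus the shorter of these two intervals, rescaled to $[0,1]$. If $I^t_\alpha$ is longer, top wins, $\alpha$ is the winner and $\beta$ the loser; in $\mathcal V(T)$ the first return map acts on $I_\beta^t$ as $T^2$, and on the points that remain of every other $I_i^t$ as $T$ (labels unchanged). If $I^b_\beta$ is longer, bottom wins, $\beta$ is the winner and $\alpha$ the loser; $I_\beta^t$ is cut at the preimage of the left endpoint of $I^t_\alpha$ and its right part, on which the first return map is $T^2$, receives the label $\alpha$. Set $Z(T)=\mathrm{Id}+E_{\mathrm{loser},\mathrm{winner}}$. $T$ is infinitely renormalizable if $\mathcal V^n(T)$ is defined for all $n$; its rotation number $\gamma(T)$ is then the sequence $(\gamma_n)_{n\ge0}$, where $\gamma_n$ consists of the combinatorial datum of $\mathcal V^n(T)$ and the type (top or bottom) of the step from $\mathcal V^n(T)$ to $\mathcal V^{n+1}(T)$. It is irrational if each label is the winner for infinitely many $n$, and periodic with period $k_0\ge1$ if $\gamma_{n+k_0}=\gamma_n$ for all $n\ge0$. In the periodic case the period matrix is $A=Z(\mathcal V^{k_0-1}T)\cdots Z(\mathcal V T)\,Z(T)$. Write $\mathbb R^d=E_s\oplus E_c\oplus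 E_u$ for the sums of the (real parts of the) generalized eigenspaces of $A$ for eigenvalues of modulus $<1$, $=1$, $>1$. Let $g$ be the genus of the surface suspended over $T$: $d=2g+\kappa-1$, where $\kappa$ is the number of vertices of the surface obtained from a $2d$-gon, with top sides labelled $\pi_t(1),\dots,\pi_t(d)$ and bottom sides labelled $\pi_b(1),\dots,\pi_b(d)$ from left to right, by gluing the sides with equal labels by translations. $T$ is of hyperbolic periodic type if $\pi$ is irreducible, $T$ is infinitely renormalizable, $\gamma(T)$ is irrational and periodic, and $A$ is hyperbolic, i.e. $\dim E_u=\dim E_s=g$. **Proposition (affine shadowing dichotomy, periodic type).** Let $T$ be a GIET of class $C^r$, $r\ge 2$, of hyperbolic periodic type, whose rotation number has period $k_0$. Put $\mathcal R=\mathcal V^{k_0}$ and $\omega_n=\omega(\mathcal R^n(T))\in\mathbb R^d$. Then either 1. $(\omega_n)_{n\in\mathbb N}$ is bounded, or 2. there exists $v\in E_u$ such that $\omega_n=A^n v+O(1)$, i.e. the sequence $(\omega_n-A^nv)_{n\in\mathbb N}$ is bounded. -/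

import Mathlib

open Set

/-! ### Generalized interval exchange transformations -/

/-- The intervals `[a i, b i)`, `i : Fin d`, are non-degenerate and form a partition of `[0, L)`. -/
structure IsIntervalPartition {d : ℕ} (L : ℝ) (a b : Fin d → ℝ) : Prop where
  lt : ∀ i, a i < b i
  disj : ∀ i j, i ≠ j → Disjoint (Ico (a i) (b i)) (Ico (a j) (b j))
  cover : ⋃ i, Ico (a i) (b i) = Ico 0 L

/-- `g` restricts to an orientation preserving diffeomorphism of class `C^r` of the closed interval
`[a, b]` onto the closed interval `[c, e]`. -/
structure IsIntervalDiffeo (r : ℕ∞) (g : ℝ → ℝ) (a b c e : ℝ) : Prop where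
  contDiffOn : ContDiffOn ℝ (r : WithTop ℕ∞) g (Icc a b)
  deriv_pos : ∀ x ∈ Icc a b, 0 < derivWithin g (Icc a b) x
  map_left : g a = c
  map_right : g b = e

/-- `f` is a generalized interval exchange of class `C^r` of the interval `[0, L)` with top intervals
`[a i, b i)` and bottom intervals `[c i, e i)`: on each top interval, `f` extends to a
`C^r`-diffeomorphism between the closures of the `i`-th top and of the `i`-th bottom interval.
(Maps are normalised to be right continuous at the division points.) -/
structure IsGIETOn {d : ℕ} (r : ℕ∞) (L : ℝ) (f : ℝ → ℝ) (a b c e : Fin d → ℝ) : Prop where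
  top : IsIntervalPartition L a b
  bot : IsIntervalPartition L c e
  branch : ∀ i, ∃ g : ℝ → ℝ,
    IsIntervalDiffeo r g (a i) (b i) (c i) (e i) ∧ EqOn f g (Ico (a i) (b i))

/-- A generalized interval exchange transformation (GIET) of `d` intervals of class `C^r`. The
intervals carry labels in `Fin d`: `I_i^t = [topL i, topR i)` and `I_i^b = [botL i, botR i)`.
Only the values of `toFun` on `[0, 1)` matter. -/
structure GIET (d : ℕ) (r : ℕ∞) where
  two_le : 2 ≤ d
  toFun : ℝ → ℝ
  topL : Fin d → ℝ
  topR : Fin d → ℝ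
  botL : Fin d → ℝ
  botR : Fin d → ℝ
  isGIET : IsGIETOn r 1 toFun topL topR botL botR

/-! ### The first return map is a GIET: helper facts -/

namespace IsIntervalDiffeo

variable {r : ℕ∞} {g h : ℝ → ℝ} {a b c e p q : ℝ}

theorem hasDeriv (hg : IsIntervalDiffeo r g a b c e) {x : ℝ} (hx : x ∈ Icc a b) :
    HasDerivWithinAt g (derivWithin g (Icc a b) x) (Icc a b) x := by
  have h1 := hg.deriv_pos x hx
  have : DifferentiableWithinAt ℝ g (Icc a b) x := by
    by_contra hn
    rw [derivWithin_zero_of_not_differentiableWithinAt hn] at h1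
    exact lt_irrefl _ h1
  exact this.hasDerivWithinAt

theorem strictMonoOn (hg : IsIntervalDiffeo r g a b c e) : StrictMonoOn g (Icc a b) := by
  refine strictMonoOn_of_deriv_pos (convex_Icc a b) hg.contDiffOn.continuousOn ?_
  intro x hx
  rw [interior_Icc] at hx
  have h1 := (hg.hasDeriv (Ioo_subset_Icc_self hx)).hasDerivAt (Icc_mem_nhds hx.1 hx.2)
  rw [h1.deriv]
  exact hg.deriv_pos x (Ioo_subset_Icc_self hx)

theorem of_hasDeriv (hab : a < b) {g' : ℝ → ℝ} (h1 : ContDiffOn ℝ (r : WithTop ℕ∞) g (Icc a b))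
    (h2 : ∀ x ∈ Icc a b, HasDerivWithinAt g (g' x) (Icc a b) x) (h3 : ∀ x ∈ Icc a b, 0 < g' x)
    (h4 : g a = c) (h5 : g b = e) : IsIntervalDiffeo r g a b c e := by
  refine ⟨h1, fun x hx => ?_, h4, h5⟩
  rw [(h2 x hx).derivWithin (uniqueDiffOn_Icc hab x hx)]
  exact h3 x hx

theorem restrict (hg : IsIntervalDiffeo r g a b c e) (h1 : a ≤ p) (h2 : p < q) (h3 : q ≤ b) :
    IsIntervalDiffeo r g p q (g p) (g q) := by
  have hs : Icc p q ⊆ Icc a b := Icc_subset_Icc h1 h3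
  exact of_hasDeriv h2 (hg.contDiffOn.mono hs) (fun x hx => (hg.hasDeriv (hs hx)).mono hs)
    (fun x hx => hg.deriv_pos x (hs hx)) rfl rfl

theorem mapsTo (hg : IsIntervalDiffeo r g a b c e) : MapsTo g (Icc a b) (Icc c e) := by
  intro x hx
  have hab : a ≤ b := hx.1.trans hx.2
  have hm := hg.strictMonoOn.monotoneOn
  rw [← hg.map_left, ← hg.map_right]
  exact ⟨hm ⟨le_rfl, hab⟩ hx hx.1, hm hx ⟨hab, le_rfl⟩ hx.2⟩

theorem comp (hab : a < b) (hg : IsIntervalDiffeo r g a b c e) (hh : IsIntervalDiffeo r h c e p q) :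
    IsIntervalDiffeo r (h ∘ g) a b p q := by
  refine of_hasDeriv hab (hh.contDiffOn.comp hg.contDiffOn hg.mapsTo)
    (fun x hx => (hh.hasDeriv (hg.mapsTo hx)).comp x (hg.hasDeriv hx) hg.mapsTo)
    (fun x hx => mul_pos (hh.deriv_pos _ (hg.mapsTo hx)) (hg.deriv_pos x hx)) ?_ ?_
  · simp [hg.map_left, hh.map_left]
  · simp [hg.map_right, hh.map_right]

theorem mul_left {l : ℝ} (hl : 0 < l) (hab : a < b) :
    IsIntervalDiffeo r (fun x => l * x) a b (l * a) (l * b) := by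
  refine of_hasDeriv hab (contDiff_const.mul contDiff_id).contDiffOn (g' := fun _ => l * 1)
    (fun x _ => ((hasDerivAt_id x).const_mul l).hasDerivWithinAt) (fun x _ => by simpa using hl)
    rfl rfl

theorem mem_Ico (hg : IsIntervalDiffeo r g a b c e) {x : ℝ} (hx : x ∈ Ico a b) :
    g x ∈ Ico c e := by
  have hab : a ≤ b := hx.1.trans hx.2.le
  refine ⟨(hg.mapsTo ⟨hx.1, hx.2.le⟩).1, ?_⟩
  rw [← hg.map_right]
  exact hg.strictMonoOn ⟨hx.1, hx.2.le⟩ ⟨hab, le_rfl⟩ hx.2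

theorem exists_eq (hab : a < b) (hg : IsIntervalDiffeo r g a b c e) {y : ℝ} (hy : y ∈ Ico c e) :
    ∃ x ∈ Ico a b, g x = y := by
  have h1 := intermediate_value_Ico hab.le hg.contDiffOn.continuousOn
  rw [hg.map_left, hg.map_right] at h1
  exact h1 hy

end IsIntervalDiffeo

namespace IsIntervalPartition

variable {d : ℕ} {L : ℝ} {a b : Fin d → ℝ}

theorem nonneg_and_le (h : IsIntervalPartition L a b) (i : Fin d) : 0 ≤ a i ∧ b i ≤ L := by
  have h1 : Ico (a i) (b i) ⊆ Ico 0 L := by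
    rw [← h.cover]; exact subset_iUnion (fun i => Ico (a i) (b i)) i
  exact (Ico_subset_Ico_iff (h.lt i)).1 h1

theorem le_of_last (h : IsIntervalPartition L a b) {i α : Fin d} (hα : b α = L) (hi : i ≠ α) :
    b i ≤ a α := by
  by_contra hn
  push Not at hn
  have h1 := h.lt i
  have h2 := h.lt α
  have h3 := (h.nonneg_and_le i).2
  have hi1 : max (a i) (a α) ∈ Ico (a i) (b i) := ⟨le_max_left _ _, max_lt h1 hn⟩
  have hi2 : max (a i) (a α) ∈ Ico (a α) (b α) := ⟨le_max_right _ _, max_lt (by linarith) h2⟩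
  exact Set.disjoint_left.1 (h.disj i α hi) hi1 hi2

theorem exists_mem (h : IsIntervalPartition L a b) {x : ℝ} (hx : x ∈ Ico 0 L) :
    ∃ i, x ∈ Ico (a i) (b i) := by
  rw [← h.cover] at hx
  simpa using hx

theorem cut (h : IsIntervalPartition L a b) {α : Fin d} (hα : b α = L) {l : ℝ} (h1 : a α < l)
    (h2 : l < L) : IsIntervalPartition l a (Function.update b α l) := by
  have hle : ∀ i, Function.update b α l i ≤ b i := by
    intro i
    rcases eq_or_ne i α with rfl | hi
    · simp [hα, h2.le]
    · simp [hi]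
  have hsub : ∀ i, Ico (a i) (Function.update b α l i) ⊆ Ico (a i) (b i) :=
    fun i => Ico_subset_Ico_right (hle i)
  refine ⟨fun i => ?_, fun i j hij => (h.disj i j hij).mono (hsub i) (hsub j), ?_⟩
  · rcases eq_or_ne i α with rfl | hi
    · simp [h1]
    · simp [hi, h.lt i]
  · ext x
    simp only [mem_iUnion]
    constructor
    · rintro ⟨i, hx⟩
      refine ⟨(h.nonneg_and_le i).1.trans hx.1, ?_⟩
      rcases eq_or_ne i α with rfl | hi
      · simpa using hx.2
      · have := h.le_of_last hα hi
        have h4 := (hsub i hx).2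
        linarith
    · intro hx
      obtain ⟨i, hi⟩ := h.exists_mem (x := x) ⟨hx.1, hx.2.trans h2⟩
      refine ⟨i, hi.1, ?_⟩
      rcases eq_or_ne i α with rfl | hne
      · simpa using hx.2
      · simpa [hne] using hi.2

theorem split (h : IsIntervalPartition L a b) {α β : Fin d} (hβ : b β = L) (hne : α ≠ β) {p : ℝ}
    (h1 : a α < p) (h2 : p < b α) :
    IsIntervalPartition (a β) (Function.update a β p)
      (Function.update (Function.update b β (b α)) α p) := by
  have hd := h.disj
  have key : ∀ i, i ≠ α → i ≠ β → Ico (Function.update a β p i)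
      (Function.update (Function.update b β (b α)) α p i) = Ico (a i) (b i) := by
    intro i hi hi'
    simp [hi, hi']
  have keyα : Ico (Function.update a β p α)
      (Function.update (Function.update b β (b α)) α p α) = Ico (a α) p := by
    simp [hne]
  have keyβ : Ico (Function.update a β p β)
      (Function.update (Function.update b β (b α)) α p β) = Ico p (b α) := by
    simp [hne.symm]
  have sα : Ico (a α) p ⊆ Ico (a α) (b α) := Ico_subset_Ico_right h2.le
  have sβ : Ico p (b α) ⊆ Ico (a α) (b α) := Ico_subset_Ico_left h1.le
  have dαβ : Disjoint (Ico (a α) p) (Ico p (b α)) := by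
    rw [Set.disjoint_left]; intro x hx hx'; exact absurd hx.2 (not_lt.2 hx'.1)
  refine ⟨fun i => ?_, fun i j hij => ?_, ?_⟩
  · rcases eq_or_ne i α with rfl | hi
    · simpa [hne] using h1
    · rcases eq_or_ne i β with rfl | hi'
      · simpa [hi] using h2
      · simpa [hi, hi'] using h.lt i
  · rcases eq_or_ne i α with rfl | hi
    · rw [keyα]
      rcases eq_or_ne j β with rfl | hj'
      · rw [keyβ]; exact dαβ
      · rw [key j hij.symm hj']; exact (hd _ _ hij).mono_left sα
    · rcases eq_or_ne i β with rfl | hi'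
      · rw [keyβ]
        rcases eq_or_ne j α with rfl | hj
        · rw [keyα]; exact dαβ.symm
        · rw [key j hj hij.symm]; exact (hd _ _ hj.symm).mono_left sβ
      · rw [key i hi hi']
        rcases eq_or_ne j α with rfl | hj
        · rw [keyα]; exact (hd _ _ hi).mono_right sα
        · rcases eq_or_ne j β with rfl | hj'
          · rw [keyβ]; exact (hd _ _ hi).mono_right sβ
          · rw [key j hj hj']; exact hd _ _ hij
  · have hnn := h.nonneg_and_le
    have hlast : ∀ i, i ≠ β → b i ≤ a β := fun i hi => h.le_of_last hβ hi
    ext x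
    simp only [mem_iUnion]
    constructor
    · rintro ⟨i, hx⟩
      have : ∃ j, j ≠ β ∧ x ∈ Ico (a j) (b j) := by
        rcases eq_or_ne i α with rfl | hi
        · rw [keyα] at hx; exact ⟨i, hne, sα hx⟩
        · rcases eq_or_ne i β with rfl | hi'
          · rw [keyβ] at hx; exact ⟨α, hne, sβ hx⟩
          · rw [key i hi hi'] at hx; exact ⟨i, hi', hx⟩
      obtain ⟨j, hj, hx⟩ := this
      exact ⟨(hnn j).1.trans hx.1, hx.2.trans_le (hlast j hj)⟩
    · intro hx
      have hβL := h.lt β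
      obtain ⟨i, hi⟩ := h.exists_mem (x := x) ⟨hx.1, by linarith [hx.2]⟩
      have hiβ : i ≠ β := by
        rintro rfl; exact absurd hx.2 (not_lt.2 hi.1)
      rcases eq_or_ne i α with rfl | hiα
      · rcases lt_or_ge x p with hxp | hxp
        · exact ⟨i, by rw [keyα]; exact ⟨hi.1, hxp⟩⟩
        · exact ⟨β, by rw [keyβ]; exact ⟨hxp, hi.2⟩⟩
      · exact ⟨i, by rw [key i hiα hiβ]; exact hi⟩

theorem rescale (h : IsIntervalPartition L a b) (hL : 0 < L) :
    IsIntervalPartition 1 (fun i => a i / L) (fun i => b i / L) := by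
  have key : ∀ u v : ℝ, Ico (u / L) (v / L) = (fun x => x * L) ⁻¹' Ico u v := by
    intro u v
    ext x
    simp only [mem_Ico, mem_preimage, div_le_iff₀ hL, lt_div_iff₀ hL]
  refine ⟨fun i => div_lt_div_of_pos_right (h.lt i) hL, fun i j hij => ?_, ?_⟩
  · simp only [key]
    exact (h.disj i j hij).preimage _
  · simp only [key]
    rw [← preimage_iUnion, h.cover, ← key, zero_div, div_self hL.ne']

theorem exists_last (h : IsIntervalPartition L a b) (hL : 0 < L) : ∃ i, b i = L := by
  by_contra hn
  push Not at hn
  have h1 : ∀ i, b i < L := fun i => lt_of_le_of_ne (h.nonneg_and_le i).2 (hn i)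
  obtain ⟨i0, -⟩ := h.exists_mem (x := 0) ⟨le_rfl, hL⟩
  obtain ⟨m, -, hm⟩ := Finset.exists_max_image Finset.univ b ⟨i0, Finset.mem_univ _⟩
  have h2 : 0 ≤ b m := (h.nonneg_and_le m).1.trans (h.lt m).le
  obtain ⟨j, hj⟩ := h.exists_mem (x := b m) ⟨h2, h1 m⟩
  exact absurd hj.2 (not_lt.2 (hm j (Finset.mem_univ _)))

theorem eq_of_mem (h : IsIntervalPartition L a b) {i j : Fin d} {x : ℝ} (hi : x ∈ Ico (a i) (b i))
    (hj : x ∈ Ico (a j) (b j)) : i = j := by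
  by_contra hij
  exact Set.disjoint_left.1 (h.disj i j hij) hi hj

/-- The interval in last position (for the ordering by left endpoints) ends at `L`. -/
theorem last_sort (h : IsIntervalPartition L a b) (hL : 0 < L) (k : Fin d)
    (hk : ∀ j : Fin d, j ≤ k) : b (Tuple.sort a k) = L := by
  obtain ⟨m, hm⟩ := h.exists_last hL
  have h1 : a m ≤ a (Tuple.sort a k) := by
    have := Tuple.monotone_sort a (hk ((Tuple.sort a).symm m))
    simpa using this
  have h2 : Tuple.sort a k = m := by
    by_contra hne
    have := h.le_of_last hm hne
    have := h.lt (Tuple.sort a k)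
    linarith
  rw [h2, hm]

end IsIntervalPartition

/-- The first return map of `f` to the set `J`. -/
noncomputable def firstReturn (f : ℝ → ℝ) (J : Set ℝ) (x : ℝ) : ℝ :=
  f^[sInf {n : ℕ | 1 ≤ n ∧ f^[n] x ∈ J}] x

theorem firstReturn_one {f : ℝ → ℝ} {J : Set ℝ} {x : ℝ} (h : f x ∈ J) :
    firstReturn f J x = f x := by
  have : sInf {n : ℕ | 1 ≤ n ∧ f^[n] x ∈ J} = 1 := by
    apply le_antisymm
    · exact Nat.sInf_le ⟨le_rfl, by simpa using h⟩
    · exact le_csInf ⟨1, le_rfl, by simpa using h⟩ (fun n hn => hn.1)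
  rw [firstReturn, this, Function.iterate_one]

theorem firstReturn_two {f : ℝ → ℝ} {J : Set ℝ} {x : ℝ} (h : f x ∉ J) (h' : f (f x) ∈ J) :
    firstReturn f J x = f (f x) := by
  have hm : 2 ∈ {n : ℕ | 1 ≤ n ∧ f^[n] x ∈ J} := ⟨by norm_num, by simpa using h'⟩
  have : sInf {n : ℕ | 1 ≤ n ∧ f^[n] x ∈ J} = 2 := by
    apply le_antisymm
    · exact Nat.sInf_le hm
    · refine le_csInf ⟨2, hm⟩ (fun n hn => ?_)
      by_contra hlt
      have h1 : n = 1 := by have := hn.1; omega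
      subst h1
      exact h (by simpa using hn.2)
  rw [firstReturn, this]
  rfl

namespace IsGIETOn

variable {d : ℕ} {r : ℕ∞} {L : ℝ} {f : ℝ → ℝ} {a b c e : Fin d → ℝ}

theorem mem_bot (h : IsGIETOn r L f a b c e) {i : Fin d} {x : ℝ} (hx : x ∈ Ico (a i) (b i)) :
    f x ∈ Ico (c i) (e i) := by
  obtain ⟨g, hg, hfg⟩ := h.branch i
  rw [hfg hx]
  exact hg.mem_Ico hx

theorem exists_preimage (h : IsGIETOn r L f a b c e) {i : Fin d} {y : ℝ}
    (hy : y ∈ Ico (c i) (e i)) : ∃ x ∈ Ico (a i) (b i), f x = y := by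
  obtain ⟨g, hg, hfg⟩ := h.branch i
  obtain ⟨x, hx, hxy⟩ := hg.exists_eq (h.top.lt i) hy
  exact ⟨x, hx, by rw [hfg hx, hxy]⟩

theorem strictMonoOn (h : IsGIETOn r L f a b c e) (i : Fin d) :
    StrictMonoOn f (Ico (a i) (b i)) := by
  obtain ⟨g, hg, hfg⟩ := h.branch i
  intro x hx y hy hxy
  rw [hfg hx, hfg hy]
  exact hg.strictMonoOn ⟨hx.1, hx.2.le⟩ ⟨hy.1, hy.2.le⟩ hxy

theorem rescale (h : IsGIETOn r L f a b c e) (hL : 0 < L) :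
    IsGIETOn r 1 (fun x => f (L * x) / L) (fun i => a i / L) (fun i => b i / L)
      (fun i => c i / L) (fun i => e i / L) := by
  refine ⟨h.top.rescale hL, h.bot.rescale hL, fun i => ?_⟩
  obtain ⟨g, hg, hfg⟩ := h.branch i
  have hab : a i / L < b i / L := div_lt_div_of_pos_right (h.top.lt i) hL
  have h1 := IsIntervalDiffeo.mul_left (r := r) hL hab
  rw [mul_div_cancel₀ _ hL.ne', mul_div_cancel₀ _ hL.ne'] at h1
  have h2 := IsIntervalDiffeo.mul_left (r := r) (inv_pos.2 hL) (h.bot.lt i)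
  have h3 := (h1.comp hab hg).comp hab h2
  refine ⟨_, by simpa [div_eq_inv_mul] using h3, ?_⟩
  intro x hx
  have hx' : L * x ∈ Ico (a i) (b i) := by
    constructor
    · have := (div_le_iff₀ hL).1 hx.1; linarith
    · have := (lt_div_iff₀ hL).1 hx.2; linarith
  simp [hfg hx', div_eq_inv_mul]

/-- The first return map to `[0, c β)` if the last top interval (label `α`) is longer than the last
bottom interval (label `β`). -/
theorem top_step (h : IsGIETOn r L f a b c e) {α β : Fin d} (hα : b α = L) (hβ : e β = L)
    (hne : α ≠ β) (hlt : a α < c β) :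
    IsGIETOn r (c β) (firstReturn f (Ico 0 (c β))) a (Function.update b α (c β))
      (Function.update c β (f (c β)))
      (Function.update (Function.update e β (e α)) α (f (c β))) := by
  have hcL : c β < L := hβ ▸ h.bot.lt β
  have hmem : c β ∈ Ico (a α) (b α) := ⟨hlt.le, by rw [hα]; exact hcL⟩
  have haα : a α ∈ Ico (a α) (b α) := ⟨le_rfl, h.top.lt α⟩
  obtain ⟨g, hg, hfg⟩ := h.branch α
  have hp1 : c α < f (c β) := by
    have h1 := h.strictMonoOn α haα hmem hlt
    have h2 := (h.mem_bot haα).1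
    linarith
  have hp2 : f (c β) < e α := (h.mem_bot hmem).2
  have hret : ∀ i, i ≠ β → ∀ x ∈ Ico (a i) (b i), f x ∈ Ico 0 (c β) := by
    intro i hi x hx
    have h1 := h.mem_bot hx
    exact ⟨(h.bot.nonneg_and_le i).1.trans h1.1, h1.2.trans_le (h.bot.le_of_last hβ hi)⟩
  refine ⟨h.top.cut hα hlt hcL, h.bot.split hβ hne hp1 hp2, fun i => ?_⟩
  rcases eq_or_ne i α with rfl | hiα
  · refine ⟨g, ?_, ?_⟩
    · have := hg.restrict le_rfl hlt (hα ▸ hcL.le)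
      rw [hg.map_left, ← hfg hmem] at this
      simpa [hne] using this
    · intro x hx
      have hx' : x ∈ Ico (a i) (b i) := ⟨hx.1, by
        have := hx.2
        simp only [Function.update_self] at this
        linarith⟩
      rw [firstReturn_one (hret i hne x hx'), hfg hx']
  · rcases eq_or_ne i β with rfl | hiβ
    · obtain ⟨k, hk, hfk⟩ := h.branch i
      have h1 := hg.restrict hlt.le (hα ▸ hcL) le_rfl
      rw [hα, ← hβ, ← hfg hmem, hβ, ← hα, hg.map_right] at h1
      rw [hα, ← hβ] at h1
      refine ⟨g ∘ k, ?_, ?_⟩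
      · simpa [hiα] using hk.comp (h.top.lt i) h1
      · intro x hx
        have hx' : x ∈ Ico (a i) (b i) := by simpa [hiα] using hx
        have hfx := h.mem_bot hx'
        have hfx' : f x ∈ Ico (a α) (b α) := ⟨hlt.le.trans hfx.1, by rw [hα, ← hβ]; exact hfx.2⟩
        rw [firstReturn_two (fun hn => absurd hn.2 (not_lt.2 hfx.1)) (hret α hne _ hfx'),
          hfg hfx', hfk hx']
        rfl
    · obtain ⟨k, hk, hfk⟩ := h.branch i
      refine ⟨k, by simpa [hiα, hiβ] using hk, ?_⟩
      intro x hx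
      have hx' : x ∈ Ico (a i) (b i) := by simpa [hiα] using hx
      rw [firstReturn_one (hret i hiβ x hx'), hfk hx']

/-- The first return map to `[0, a α)` if the last bottom interval (label `β`) is longer than the
last top interval (label `α`); here `q` is the preimage of `a α` in the `β`-th top interval. -/
theorem bot_step (h : IsGIETOn r L f a b c e) {α β : Fin d} (hα : b α = L) (hβ : e β = L)
    (hne : α ≠ β) (hlt : c β < a α) {q : ℝ} (hq : q ∈ Ico (a β) (b β)) (hfq : f q = a α) :
    IsGIETOn r (a α) (firstReturn f (Ico 0 (a α))) (Function.update a α q)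
      (Function.update (Function.update b α (b β)) β q) c (Function.update e β (a α)) := by
  have haL : a α < L := hα ▸ h.top.lt α
  obtain ⟨g, hg, hfg⟩ := h.branch β
  have hgq : g q = a α := by rw [← hfg hq, hfq]
  have hq1 : a β < q := by
    rcases hq.1.eq_or_lt with hq' | hq'
    · rw [← hq', hg.map_left] at hgq
      exact absurd hgq hlt.ne
    · exact hq'
  have hret : ∀ i, i ≠ β → ∀ x ∈ Ico (a i) (b i), f x ∈ Ico 0 (a α) := by
    intro i hi x hx
    have h1 := h.mem_bot hx
    exact ⟨(h.bot.nonneg_and_le i).1.trans h1.1,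
      (h1.2.trans_le (h.bot.le_of_last hβ hi)).trans hlt⟩
  refine ⟨h.top.split hα hne.symm hq1 hq.2, h.bot.cut hβ hlt haL, fun i => ?_⟩
  rcases eq_or_ne i β with rfl | hiβ
  · refine ⟨g, ?_, ?_⟩
    · have := hg.restrict le_rfl hq1 hq.2.le
      rw [hg.map_left, hgq] at this
      simpa [hne.symm] using this
    · intro x hx
      simp only [Function.update_self, Function.update_of_ne hne.symm] at hx
      have hx' : x ∈ Ico (a i) (b i) := ⟨hx.1, hx.2.trans hq.2⟩
      have h1 : f x < a α := hfq ▸ h.strictMonoOn i hx' hq hx.2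
      have h2 : f x ∈ Ico 0 (a α) := ⟨(h.bot.nonneg_and_le i).1.trans (h.mem_bot hx').1, h1⟩
      rw [firstReturn_one h2, hfg hx']
  · rcases eq_or_ne i α with rfl | hiα
    · obtain ⟨k, hk, hfk⟩ := h.branch i
      have h1 := hg.restrict hq.1 hq.2 le_rfl
      rw [hgq, hg.map_right, hβ, ← hα] at h1
      refine ⟨k ∘ g, ?_, ?_⟩
      · simpa [hne] using h1.comp hq.2 hk
      · intro x hx
        have hx1 : x ∈ Ico q (b β) := by simpa [hne] using hx
        have hx' : x ∈ Ico (a β) (b β) := ⟨hq.1.trans hx1.1, hx1.2⟩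
        have h2 : a i ≤ f x := hfq ▸ (h.strictMonoOn β).monotoneOn hq hx' hx1.1
        have hfx' : f x ∈ Ico (a i) (b i) := ⟨h2, by rw [hα, ← hβ]; exact (h.mem_bot hx').2⟩
        rw [firstReturn_two (fun hn => absurd hn.2 (not_lt.2 h2)) (hret i hne _ hfx'),
          hfk hfx', hfg hx']
        rfl
    · obtain ⟨k, hk, hfk⟩ := h.branch i
      refine ⟨k, by simpa [hiα, hiβ] using hk, ?_⟩
      intro x hx
      have hx' : x ∈ Ico (a i) (b i) := by simpa [hiα, hiβ] using hx
      rw [firstReturn_one (hret i hiβ x hx'), hfk hx']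

end IsGIETOn

namespace GIET

variable {d : ℕ} {r : ℕ∞}

/-! ### Combinatorial data -/

/-- `π_t`: the label of the `j`-th top interval from the left. -/
noncomputable def permTop (T : GIET d r) : Equiv.Perm (Fin d) := Tuple.sort T.topL

/-- `π_b`: the label of the `j`-th bottom interval from the left. -/
noncomputable def permBot (T : GIET d r) : Equiv.Perm (Fin d) := Tuple.sort T.botL

/-- The combinatorial datum of `T` is irreducible: `π_t {1, …, k} ≠ π_b {1, …, k}` for
`1 ≤ k < d`. -/
def IsIrreducible (T : GIET d r) : Prop :=
  ∀ k : ℕ, 1 ≤ k → k < d → T.permTop '' {j | j.val < k} ≠ T.permBot '' {j | j.val < k}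

/-- The last position. -/
def lastPos (T : GIET d r) : Fin d := ⟨d - 1, by have := T.two_le; omega⟩

/-- `π_t(d)`, the label of the rightmost top interval. -/
noncomputable def lastTop (T : GIET d r) : Fin d := T.permTop T.lastPos

/-- `π_b(d)`, the label of the rightmost bottom interval. -/
noncomputable def lastBot (T : GIET d r) : Fin d := T.permBot T.lastPos

theorem topR_lastTop (T : GIET d r) : T.topR T.lastTop = 1 :=
  T.isGIET.top.last_sort one_pos _ (fun j => Fin.le_def.2 (by simp [lastPos]; omega))

theorem botR_lastBot (T : GIET d r) : T.botR T.lastBot = 1 :=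
  T.isGIET.bot.last_sort one_pos _ (fun j => Fin.le_def.2 (by simp [lastPos]; omega))

/-! ### Rauzy-Veech induction -/

/-- The elementary step of Rauzy-Veech induction can be performed: the rightmost top and bottom
intervals have different lengths. (That their labels are different is automatic for irreducible
combinatorial data.) -/
def IsRenormalizable (T : GIET d r) : Prop :=
  T.lastTop ≠ T.lastBot ∧ T.topL T.lastTop ≠ T.botL T.lastBot

/-- Top wins: the rightmost top interval is longer than the rightmost bottom interval. -/
def TopWins (T : GIET d r) : Prop := T.topL T.lastTop < T.botL T.lastBot

open Classical in
/-- The winner of the elementary step. -/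
noncomputable def winner (T : GIET d r) : Fin d := if T.TopWins then T.lastTop else T.lastBot

open Classical in
/-- The loser of the elementary step. -/
noncomputable def loser (T : GIET d r) : Fin d := if T.TopWins then T.lastBot else T.lastTop

/-- `λ₁`: the elementary step induces on the interval `[0, λ₁)`, the unit interval with the
shorter of the two rightmost intervals removed. -/
noncomputable def cutPoint (T : GIET d r) : ℝ := max (T.topL T.lastTop) (T.botL T.lastBot)

/-- The normalised first return map of `T` to `[0, λ₁)`. -/
noncomputable def normalizedReturn (T : GIET d r) (x : ℝ) : ℝ :=
  firstReturn T.toFun (Ico 0 T.cutPoint) (T.cutPoint * x) / T.cutPoint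

theorem cutPoint_pos (T : GIET d r) (h : T.IsRenormalizable) : 0 < T.cutPoint := by
  have h1 := (T.isGIET.top.nonneg_and_le T.lastTop).1
  have h2 := (T.isGIET.bot.nonneg_and_le T.lastBot).1
  rcases lt_or_gt_of_ne h.2 with h3 | h3
  · exact lt_max_of_lt_right (h1.trans_lt h3)
  · exact lt_max_of_lt_left (h2.trans_lt h3)

/-- The elementary step when top wins. With `α = π_t(d)` and `β = π_b(d)`, the interval `I_α^t` loses
its right end `I_β^b`, and `I_α^b` is divided at `T(λ₁)` into `I_α^b` (left) and `I_β^b` (right). -/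
noncomputable def stepTop (T : GIET d r) (h : T.IsRenormalizable) (hw : T.TopWins) : GIET d r where
  two_le := T.two_le
  toFun := T.normalizedReturn
  topL i := T.topL i / T.cutPoint
  topR i := Function.update T.topR T.lastTop T.cutPoint i / T.cutPoint
  botL i := Function.update T.botL T.lastBot (T.toFun T.cutPoint) i / T.cutPoint
  botR i := Function.update (Function.update T.botR T.lastBot (T.botR T.lastTop))
    T.lastTop (T.toFun T.cutPoint) i / T.cutPoint
  isGIET := by
    have hc : T.cutPoint = T.botL T.lastBot := max_eq_right (le_of_lt hw)
    have hpos := T.cutPoint_pos h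
    have h1 := T.isGIET.top_step T.topR_lastTop T.botR_lastBot h.1 hw
    rw [← hc] at h1
    exact h1.rescale hpos

/-- The preimage of `λ₁` in the top interval with label `π_b(d)`. -/
noncomputable def cutPreimage (T : GIET d r) : ℝ :=
  Function.invFunOn T.toFun (Ico (T.topL T.lastBot) (T.topR T.lastBot)) T.cutPoint

/-- The elementary step when bottom wins. With `α = π_t(d)` and `β = π_b(d)`, the interval `I_β^b`
loses its right end `I_α^t`, and `I_β^t` is divided at the preimage of `λ₁` into `I_β^t` (left)
and `I_α^t` (right). -/
noncomputable def stepBot (T : GIET d r) (h : T.IsRenormalizable) (hw : ¬ T.TopWins) :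
    GIET d r where
  two_le := T.two_le
  toFun := T.normalizedReturn
  topL i := Function.update T.topL T.lastTop T.cutPreimage i / T.cutPoint
  topR i := Function.update (Function.update T.topR T.lastTop (T.topR T.lastBot))
    T.lastBot T.cutPreimage i / T.cutPoint
  botL i := T.botL i / T.cutPoint
  botR i := Function.update T.botR T.lastBot T.cutPoint i / T.cutPoint
  isGIET := by
    have hw' : T.botL T.lastBot < T.topL T.lastTop := lt_of_le_of_ne (not_lt.1 hw) h.2.symm
    have hc : T.cutPoint = T.topL T.lastTop := max_eq_left hw'.le
    have hpos := T.cutPoint_pos h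
    have hmem : T.cutPoint ∈ Ico (T.botL T.lastBot) (T.botR T.lastBot) := by
      rw [hc, T.botR_lastBot]
      exact ⟨hw'.le, T.topR_lastTop ▸ T.isGIET.top.lt T.lastTop⟩
    have hex := T.isGIET.exists_preimage hmem
    have h1 := T.isGIET.bot_step T.topR_lastTop T.botR_lastBot h.1 hw'
      (Function.invFunOn_mem hex) ((Function.invFunOn_eq hex).trans hc)
    rw [← hc] at h1
    exact h1.rescale hpos

open Classical in
/-- The Rauzy-Veech renormalization operator `𝒱` (with the junk value `T` if the elementary step
cannot be performed). -/
noncomputable def rauzyVeech (T : GIET d r) : GIET d r :=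
  if h : T.IsRenormalizable then
    if hw : T.TopWins then T.stepTop h hw else T.stepBot h hw
  else T

/-- All iterates `𝒱ⁿ(T)` are well defined. -/
def IsInfinitelyRenormalizable (T : GIET d r) : Prop :=
  ∀ n : ℕ, (rauzyVeech^[n] T).IsRenormalizable

/-! ### Rotation numbers and periodic type -/

/-- The arrow of the Rauzy diagram issued from the combinatorial datum `(π_t, π_b)` of `T` which
corresponds to the elementary step for `T`; it is determined by `(π_t, π_b)` and the type
(top or bottom) of the step. -/
noncomputable def arrow (T : GIET d r) : Equiv.Perm (Fin d) × Equiv.Perm (Fin d) × Prop :=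
  (T.permTop, T.permBot, T.TopWins)

/-- The combinatorial rotation number `γ(T) = γ_0 γ_1 γ_2 ⋯`. -/
noncomputable def rotationNumber (T : GIET d r) (n : ℕ) :
    Equiv.Perm (Fin d) × Equiv.Perm (Fin d) × Prop :=
  (rauzyVeech^[n] T).arrow

/-- The rotation number is irrational (`∞`-complete): each label wins infinitely often. -/
def HasIrrationalRotationNumber (T : GIET d r) : Prop :=
  ∀ j : Fin d, ∀ N : ℕ, ∃ n ≥ N, (rauzyVeech^[n] T).winner = j

/-- `T` (with irreducible combinatorial datum) is of periodic type, and `k₀` is a period of its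
rotation number. -/
structure IsPeriodicType (T : GIET d r) (k₀ : ℕ) : Prop where
  irreducible : T.IsIrreducible
  renormalizable : T.IsInfinitelyRenormalizable
  irrational : T.HasIrrationalRotationNumber
  period_pos : 0 < k₀
  periodic : ∀ n : ℕ, T.rotationNumber (n + k₀) = T.rotationNumber n

/-! ### The cocycle and the period matrix -/

/-- The matrix `Z(T) = Id + E_{loser, winner}` of the elementary step. -/
noncomputable def stepMatrix (T : GIET d r) : Matrix (Fin d) (Fin d) ℝ :=
  1 + Matrix.single T.loser T.winner 1

/-- The product `Z(𝒱ⁿ⁻¹ T) ⋯ Z(𝒱 T) Z(T)`. -/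
noncomputable def cocycle (T : GIET d r) : ℕ → Matrix (Fin d) (Fin d) ℝ
  | 0 => 1
  | n + 1 => (rauzyVeech^[n] T).stepMatrix * cocycle T n

end GIET

/-- The real vectors in the sum of the (complex) generalized eigenspaces of the real matrix `A` for
the eigenvalues `μ` such that `P ‖μ‖` holds. -/
noncomputable def spectralSubspace {d : ℕ} (A : Matrix (Fin d) (Fin d) ℝ) (P : ℝ → Prop) :
    Submodule ℝ (Fin d → ℝ) :=
  Submodule.comap (Complex.ofRealCLM.toLinearMap.compLeft (Fin d))
    ((⨆ μ ∈ {μ : ℂ | P ‖μ‖},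
      Module.End.maxGenEigenspace (Matrix.toLin' (A.map Complex.ofReal)) μ).restrictScalars ℝ)

/-- The stable space `E_s` of `A`. -/
noncomputable def stableSpace {d : ℕ} (A : Matrix (Fin d) (Fin d) ℝ) : Submodule ℝ (Fin d → ℝ) :=
  spectralSubspace A (fun ρ => ρ < 1)

/-- The unstable space `E_u` of `A`. -/
noncomputable def unstableSpace {d : ℕ} (A : Matrix (Fin d) (Fin d) ℝ) : Submodule ℝ (Fin d → ℝ) :=
  spectralSubspace A (fun ρ => 1 < ρ)

namespace GIET

variable {d : ℕ} {r : ℕ∞}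

/-! ### Genus and hyperbolicity -/

/-- Identifications of the vertices `U_0, …, U_d` (`Sum.inl`) and `V_0, …, V_d` (`Sum.inr`) of the
polygon with top sides `[U_{i-1}, U_i]` labelled `π_t(i)` and bottom sides `[V_{i-1}, V_i]`
labelled `π_b(i)`: one has `U_0 = V_0` and `U_d = V_d`, and the two sides with the same label are
glued. Positions are counted from `0`, so the side in position `i` joins the vertices `i` and
`i + 1`. -/
inductive VertexGlued (T : GIET d r) : Fin (d + 1) ⊕ Fin (d + 1) → Fin (d + 1) ⊕ Fin (d + 1) → Prop
  | first : VertexGlued T (Sum.inl 0) (Sum.inr 0)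
  | last : VertexGlued T (Sum.inl (Fin.last d)) (Sum.inr (Fin.last d))
  | left (i j : Fin d) (h : T.permTop i = T.permBot j) :
      VertexGlued T (Sum.inl i.castSucc) (Sum.inr j.castSucc)
  | right (i j : Fin d) (h : T.permTop i = T.permBot j) :
      VertexGlued T (Sum.inl i.succ) (Sum.inr j.succ)

/-- `κ`, the number of singularities of the surface suspended over `T`, i.e. the number of points
of the glued polygon that come from vertices. -/
noncomputable def numSing (T : GIET d r) : ℕ := Nat.card (Quot T.VertexGlued)

/-- The genus `g` of the surface suspended over `T`, given by `d = 2 g + κ - 1`. -/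
noncomputable def genus (T : GIET d r) : ℕ := (d + 1 - T.numSing) / 2

/-- `T` is of hyperbolic periodic type, `k₀` being a period of its rotation number: it is of periodic
type and its period matrix `A` is hyperbolic, that is, `A` has `g` eigenvalues of modulus `> 1` and
`g` of modulus `< 1`, counted with multiplicity. -/
structure IsHyperbolicPeriodicType (T : GIET d r) (k₀ : ℕ) : Prop
    extends T.IsPeriodicType k₀ where
  unstable_dim : Module.finrank ℝ (unstableSpace (T.cocycle k₀)) = T.genus
  stable_dim : Module.finrank ℝ (stableSpace (T.cocycle k₀)) = T.genus

/-! ### Shape log-slope vectors -/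

/-- The shape-slope vector `ρ(T)`: `ρ_i = |I_i^b| / |I_i^t|` is the slope of the affine interval
exchange which maps `I_i^t` to `I_i^b` for every `i` (equivalently, the mean of `T'` on `I_i^t`). -/
noncomputable def shapeSlope (T : GIET d r) (i : Fin d) : ℝ :=
  (T.botR i - T.botL i) / (T.topR i - T.topL i)

/-- The shape log-slope vector `ω(T)`. -/
noncomputable def logSlope (T : GIET d r) : Fin d → ℝ := fun i => Real.log (T.shapeSlope i)

end GIET

/-! ### Linear recurrences with bounded errors -/

/-! The second alternative always holds; when `v = 0` it says that the sequence is bounded, which is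
the first.

By the mean value theorem, each coordinate of `ω(T)` is a value of `log DT` on the corresponding
interval, so it differs from any other value there by at most the total variation of `log DT`. This
variation is finite because `r ≥ 2`, and it does not increase under renormalization, since the
return orbits use disjoint pieces of the top intervals (`IsElementaryStep.totalVariation_le`). The
chain rule, applied along one period, then gives `ω_{n+1} = A ω_n + O(1)` with a uniform error
(`norm_logSlope_iterate_sub_le`).

Such a recurrence is harmless in the stable and unstable directions. In the stable direction bounded
errors stay bounded. In the unstable direction they are absorbed into the initial vector through a
convergent series in negative powers of `A`. In the central direction, however, bounded errors could
add up to linear growth, so another argument is needed there.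

That argument uses the boundary operator `D w = ∑ wᵢ ([left vertex of i] - [right vertex of i])`,
with values in functions on the `κ` vertices of the suspension. An elementary step preserves `D` if
the vertex labels are transported along, and after a full period the labels agree with the original
ones up to a permutation of the vertices. Hence `‖D (A x)‖ = ‖D x‖`. It follows that `D` vanishes on
`E_s` and `E_u`. Since the vertices are connected through the sides, `dim ker D ≤ d + 1 - κ = 2g`,
and hyperbolicity forces `ker D = E_s ⊕ E_u`.

Moreover `D ω_n` is bounded. The boundary formed from the one-sided values of `log DT` at the end
points of the intervals is exactly invariant (`IsElementaryStep.boundary_eq`), and it differs from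
`D ω_n` by a multiple of the total variation. So `ω_n` is at bounded distance from `ker D`, where
only the stable and unstable directions remain (`exists_orbit_of_recurrence`). -/

theorem summable_of_le_mul_add {a b : ℕ → ℝ} {ρ : ℝ} (ha : ∀ n, 0 ≤ a n) (hρ : ρ < 1)
    (hb : Summable b) (hb0 : ∀ n, 0 ≤ b n) (h : ∀ n, a (n + 1) ≤ ρ * a n + b n) : Summable a := by
  -- Summing the recurrence gives `S ≤ a 0 + ρ S + ∑ b` for every partial sum `S`; the bound is this
  -- inequality solved for `S`.
  refine summable_of_sum_range_le (c := (a 0 + ∑' i, b i) / (1 - ρ)) ha (fun n => ?_)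
  rw [le_div_iff₀ (by linarith)]
  have h1 : ∑ i ∈ Finset.range n, a i ≤ ∑ i ∈ Finset.range (n + 1), a i := by
    rw [Finset.sum_range_succ]; linarith [ha n]
  have h2 : ∑ i ∈ Finset.range n, a (i + 1) ≤ ∑ i ∈ Finset.range n, (ρ * a i + b i) :=
    Finset.sum_le_sum fun i _ => h i
  rw [Finset.sum_add_distrib, ← Finset.mul_sum] at h2
  have h3 := hb.sum_le_tsum (Finset.range n) (fun i _ => hb0 i)
  rw [Finset.sum_range_succ'] at h1
  linarith

/-- The vectors whose orbit under `f` is absolutely summable. -/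
def summableOrbits {𝕜 E : Type*} [NontriviallyNormedField 𝕜] [NormedAddCommGroup E]
    [NormedSpace 𝕜 E] (f : Module.End 𝕜 E) : Submodule 𝕜 E where
  carrier := {x | Summable fun n => ‖(f ^ n) x‖}
  zero_mem' := by simp [summable_zero]
  add_mem' := by
    intro x y hx hy
    refine Summable.of_nonneg_of_le (fun n => norm_nonneg _) (fun n => ?_) (hx.add hy)
    rw [map_add]
    exact norm_add_le _ _
  smul_mem' := by
    intro c x hx
    simp only [mem_ofPred_eq, map_smul, norm_smul]
    exact hx.mul_left _

/-! ### Summable orbits in generalized eigenspaces -/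

section Eigen

variable {E : Type*} [NormedAddCommGroup E] [NormedSpace ℂ E] {f g : Module.End ℂ E} {μ : ℂ}

/-- Induction on the exponent that kills `x`. With `z = (f - μ) x`, whose exponent is one less,
`f^(n+1) x = μ f^n x + f^n z`, a contracting scalar recurrence with summable forcing. Summability
replaces exponential rates, so no Jordan form is needed. -/
theorem maxGenEigenspace_le_summableOrbits (hμ : ‖μ‖ < 1) :
    f.maxGenEigenspace μ ≤ summableOrbits f := by
  intro x hx
  obtain ⟨k, hk⟩ := (Module.End.mem_maxGenEigenspace f μ x).1 hx
  clear hx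
  induction k generalizing x with
  | zero => simp at hk; subst hk; exact Submodule.zero_mem _
  | succ k ih =>
    rw [pow_succ] at hk
    have hz := ih hk
    refine summable_of_le_mul_add (fun n => norm_nonneg _) hμ hz (fun n => norm_nonneg _)
      (fun n => ?_)
    rw [← norm_smul]
    refine le_trans (le_of_eq ?_) (norm_add_le _ _)
    congr 1
    rw [pow_succ, Module.End.mul_apply, LinearMap.sub_apply, map_sub]
    simp

/-- The same induction for the inverse: `g^(n+1) z = g^n x - μ g^(n+1) x` for `z = (f - μ) x`, which
is solved for `g^(n+1) x` with contraction factor `‖μ⁻¹‖`. -/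
theorem maxGenEigenspace_le_summableOrbits_inv (hgf : g * f = 1) (hμ : 1 < ‖μ‖) :
    f.maxGenEigenspace μ ≤ summableOrbits g := by
  intro x hx
  obtain ⟨k, hk⟩ := (Module.End.mem_maxGenEigenspace f μ x).1 hx
  clear hx
  have hμ0 : μ ≠ 0 := by rintro rfl; simp at hμ; linarith
  induction k generalizing x with
  | zero => simp at hk; subst hk; exact Submodule.zero_mem _
  | succ k ih =>
    rw [pow_succ] at hk
    have hz := (summable_nat_add_iff 1).2 (ih hk)
    have hμi : ‖μ⁻¹‖ < 1 := by rw [norm_inv]; exact inv_lt_one_of_one_lt₀ hμ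
    refine summable_of_le_mul_add (fun n => norm_nonneg _) hμi (hz.mul_left ‖μ⁻¹‖)
      (fun n => by positivity) (fun n => ?_)
    rw [← norm_smul, ← norm_smul]
    refine le_trans (le_of_eq ?_) (norm_sub_le _ _)
    congr 1
    have h1 : (g ^ (n + 1)) (f x) = (g ^ n) x := by
      rw [pow_succ, Module.End.mul_apply, ← Module.End.mul_apply g f, hgf, Module.End.one_apply]
    rw [LinearMap.sub_apply, map_sub, h1]
    simp [smul_sub, smul_smul, hμ0]

end Eigen

/-! ### Real points of the spectral subspaces -/

section Spectral

variable {d : ℕ} {A B : Matrix (Fin d) (Fin d) ℝ}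

theorem mem_spectralSubspace {P : ℝ → Prop} {x : Fin d → ℝ} :
    x ∈ spectralSubspace A P ↔ (fun i => (x i : ℂ)) ∈ ⨆ μ ∈ {μ : ℂ | P ‖μ‖},
      Module.End.maxGenEigenspace (Matrix.toLin' (A.map Complex.ofReal)) μ := Iff.rfl

theorem toLin'_map_ofReal_apply (A : Matrix (Fin d) (Fin d) ℝ) (x : Fin d → ℝ) :
    Matrix.toLin' (A.map Complex.ofReal) (fun i => (x i : ℂ)) =
      fun i => ((Matrix.toLin' A x i : ℝ) : ℂ) := by
  ext i
  simp [Matrix.mulVec, dotProduct]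

theorem toLin'_map_ofReal_pow_apply (A : Matrix (Fin d) (Fin d) ℝ) (n : ℕ) (x : Fin d → ℝ) :
    (Matrix.toLin' (A.map Complex.ofReal) ^ n) (fun i => (x i : ℂ)) =
      fun i => (((Matrix.toLin' A ^ n) x i : ℝ) : ℂ) := by
  induction n with
  | zero => simp
  | succ n ih =>
    rw [pow_succ', pow_succ', Module.End.mul_apply, ih, toLin'_map_ofReal_apply]
    rfl

theorem norm_ofReal_comp (x : Fin d → ℝ) : ‖fun i => (x i : ℂ)‖ = ‖x‖ := by
  simp [Pi.norm_def, nnnorm]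

theorem mem_summableOrbits_ofReal {x : Fin d → ℝ}
    (h : (fun i => (x i : ℂ)) ∈ summableOrbits (Matrix.toLin' (A.map Complex.ofReal))) :
    x ∈ summableOrbits (Matrix.toLin' A) := by
  have h' : Summable fun n => ‖(Matrix.toLin' (A.map Complex.ofReal) ^ n) fun i => (x i : ℂ)‖ := h
  simp only [toLin'_map_ofReal_pow_apply, norm_ofReal_comp] at h'
  exact h'

theorem stableSpace_le_summableOrbits (A : Matrix (Fin d) (Fin d) ℝ) :
    stableSpace A ≤ summableOrbits (Matrix.toLin' A) := by
  intro x hx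
  have h2 : (⨆ μ ∈ {μ : ℂ | ‖μ‖ < 1},
      Module.End.maxGenEigenspace (Matrix.toLin' (A.map Complex.ofReal)) μ) ≤
      summableOrbits (Matrix.toLin' (A.map Complex.ofReal)) :=
    iSup₂_le fun μ hμ => maxGenEigenspace_le_summableOrbits hμ
  exact mem_summableOrbits_ofReal (h2 ((mem_spectralSubspace (P := fun ρ => ρ < 1)).1 hx))

theorem unstableSpace_le_summableOrbits (hBA : B * A = 1) :
    unstableSpace A ≤ summableOrbits (Matrix.toLin' B) := by
  intro x hx
  have h : Matrix.toLin' (B.map Complex.ofReal) * Matrix.toLin' (A.map Complex.ofReal) = 1 := by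
    rw [Module.End.mul_eq_comp, ← Matrix.toLin'_mul]
    have : B.map Complex.ofReal * A.map Complex.ofReal = (B * A).map Complex.ofReal :=
      (Matrix.map_mul (f := Complex.ofRealHom)).symm
    rw [this, hBA, Matrix.map_one _ Complex.ofReal_zero Complex.ofReal_one, Matrix.toLin'_one]
    rfl
  have h2 : (⨆ μ ∈ {μ : ℂ | 1 < ‖μ‖},
      Module.End.maxGenEigenspace (Matrix.toLin' (A.map Complex.ofReal)) μ) ≤
      summableOrbits (Matrix.toLin' (B.map Complex.ofReal)) :=
    iSup₂_le fun μ hμ => maxGenEigenspace_le_summableOrbits_inv h hμ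
  exact mem_summableOrbits_ofReal (h2 ((mem_spectralSubspace (P := fun ρ => 1 < ρ)).1 hx))

theorem spectralSubspace_mapsTo {P : ℝ → Prop} (hAB : Commute A B) {x : Fin d → ℝ}
    (hx : x ∈ spectralSubspace A P) : Matrix.toLin' B x ∈ spectralSubspace A P := by
  rw [mem_spectralSubspace] at hx ⊢
  rw [← toLin'_map_ofReal_apply]
  have hc : Commute (Matrix.toLin' (A.map Complex.ofReal)) (Matrix.toLin' (B.map Complex.ofReal)) := by
    have h1 : ∀ A B : Matrix (Fin d) (Fin d) ℝ,
        A.map Complex.ofReal * B.map Complex.ofReal = (A * B).map Complex.ofReal :=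
      fun A B => (Matrix.map_mul (f := Complex.ofRealHom)).symm
    rw [Commute, SemiconjBy, Module.End.mul_eq_comp, Module.End.mul_eq_comp,
      ← Matrix.toLin'_mul, ← Matrix.toLin'_mul, h1, h1, hAB.eq]
  suffices h : (⨆ μ ∈ {μ : ℂ | P ‖μ‖},
      Module.End.maxGenEigenspace (Matrix.toLin' (A.map Complex.ofReal)) μ) ≤
      (⨆ μ ∈ {μ : ℂ | P ‖μ‖},
      Module.End.maxGenEigenspace (Matrix.toLin' (A.map Complex.ofReal)) μ).comap
        (Matrix.toLin' (B.map Complex.ofReal)) from h hx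
  refine iSup₂_le fun μ hμ y hy => ?_
  exact Submodule.mem_iSup_of_mem μ (Submodule.mem_iSup_of_mem hμ
    (Module.End.mapsTo_maxGenEigenspace_of_comm hc μ hy))

end Spectral

/-! ### Recurrences on contracted and expanded subspaces -/

section Recurrence

variable {E : Type*} [NormedAddCommGroup E] [NormedSpace ℝ E] [FiniteDimensional ℝ E]
  {f g : Module.End ℝ E} {V : Submodule ℝ E}

theorem LinearMap.exists_norm_le {F : Type*} [NormedAddCommGroup F] [NormedSpace ℝ F]
    (p : E →ₗ[ℝ] F) : ∃ K, 0 ≤ K ∧ ∀ x, ‖p x‖ ≤ K * ‖x‖ :=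
  ⟨‖p.toContinuousLinearMap‖, norm_nonneg _, fun x => p.toContinuousLinearMap.le_opNorm x⟩

/-- Summability of each orbit becomes uniform on `V` by expanding in a finite basis: `c n` sums the
orbits of the basis vectors, weighted by the norms of the coordinate functionals. -/
theorem exists_summable_bound (hV : V ≤ summableOrbits f) :
    ∃ c : ℕ → ℝ, Summable c ∧ (∀ n, 0 ≤ c n) ∧ ∀ x ∈ V, ∀ n, ‖(f ^ n) x‖ ≤ c n * ‖x‖ := by
  let b := Module.finBasis ℝ V
  choose K hK0 hK using fun j => LinearMap.exists_norm_le (b.coord j)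
  refine ⟨fun n => ∑ j, K j * ‖(f ^ n) (b j : E)‖,
    summable_sum fun j _ => Summable.mul_left _ (hV (b j).2), fun n =>
      Finset.sum_nonneg fun j _ => mul_nonneg (hK0 j) (norm_nonneg _), fun x hx n => ?_⟩
  have h1 : x = ∑ j, b.coord j ⟨x, hx⟩ • (b j : E) := by
    have := congrArg Subtype.val (b.sum_repr ⟨x, hx⟩)
    rw [Submodule.coe_sum] at this
    exact this.symm
  have h2 : (f ^ n) x = ∑ j, b.coord j ⟨x, hx⟩ • (f ^ n) (b j : E) := by
    conv_lhs => rw [h1]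
    simp only [map_sum, map_smul]
  rw [h2, Finset.sum_mul]
  refine (norm_sum_le _ _).trans (Finset.sum_le_sum fun j _ => ?_)
  rw [norm_smul]
  have := hK j ⟨x, hx⟩
  calc _ ≤ K j * ‖x‖ * ‖(f ^ n) (b j : E)‖ := mul_le_mul_of_nonneg_right this (norm_nonneg _)
    _ = _ := by ring

theorem bounded_of_stable_recurrence (hV : V ≤ summableOrbits f) {s δ : ℕ → E} {C : ℝ}
    (hs : s 0 ∈ V) (hδ : ∀ n, δ n ∈ V) (hC : ∀ n, ‖δ n‖ ≤ C)
    (h : ∀ n, s (n + 1) = f (s n) + δ n) : ∃ K, ∀ n, ‖s n‖ ≤ K := by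
  obtain ⟨c, hc, hc0, hcb⟩ := exists_summable_bound hV
  have hC0 : 0 ≤ C := (norm_nonneg _).trans (hC 0)
  -- Variation of constants. The term `k = n - 1` carries the oldest error `δ 0`.
  have key : ∀ n, s n = (f ^ n) (s 0) + ∑ k ∈ Finset.range n, (f ^ k) (δ (n - 1 - k)) := by
    intro n
    induction n with
    | zero => simp
    | succ n ih =>
      rw [h, ih, Finset.sum_range_succ', map_add, map_sum, pow_succ', ← add_assoc]
      congr 2
      refine Finset.sum_congr rfl fun k _ => ?_
      rw [pow_succ', Module.End.mul_apply, show n + 1 - 1 - (k + 1) = n - 1 - k by omega]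
  refine ⟨(∑' n, c n) * ‖s 0‖ + (∑' n, c n) * C, fun n => ?_⟩
  rw [key n]
  refine (norm_add_le _ _).trans (add_le_add ?_ ?_)
  · refine (hcb _ hs n).trans (mul_le_mul_of_nonneg_right ?_ (norm_nonneg _))
    exact hc.le_tsum n (fun j _ => hc0 j)
  · refine (norm_sum_le _ _).trans ?_
    refine (Finset.sum_le_sum (g := fun k => c k * C) fun k _ => ?_).trans ?_
    · exact (hcb _ (hδ _) k).trans (mul_le_mul_of_nonneg_left (hC _) (hc0 k))
    · rw [← Finset.sum_mul]
      exact mul_le_mul_of_nonneg_right (hc.sum_le_tsum _ fun j _ => hc0 j) hC0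

theorem exists_orbit_of_unstable_recurrence (hV : V ≤ summableOrbits g) (hfg : f * g = 1)
    (hgV : ∀ x ∈ V, g x ∈ V) {u δ : ℕ → E} {C : ℝ}
    (hu : u 0 ∈ V) (hδ : ∀ n, δ n ∈ V) (hC : ∀ n, ‖δ n‖ ≤ C)
    (h : ∀ n, u (n + 1) = f (u n) + δ n) :
    ∃ v ∈ V, ∃ K, ∀ n, ‖u n - (f ^ n) v‖ ≤ K := by
  obtain ⟨c, hc, hc0, hcb⟩ := exists_summable_bound hV
  have hC0 : 0 ≤ C := (norm_nonneg _).trans (hC 0)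
  have hc1 : Summable fun j => c (j + 1) * C := ((summable_nat_add_iff 1).2 hc).mul_right C
  have hbd : ∀ n j, ‖(g ^ (j + 1)) (δ (n + j))‖ ≤ c (j + 1) * C := fun n j =>
    (hcb _ (hδ _) _).trans (mul_le_mul_of_nonneg_left (hC _) (hc0 _))
  have hsum : ∀ n, Summable fun j => (g ^ (j + 1)) (δ (n + j)) := fun n =>
    Summable.of_norm_bounded hc1 (hbd n)
  have hgpow : ∀ k, ∀ x ∈ V, (g ^ k) x ∈ V := by
    intro k
    induction k with
    | zero => intro x hx; simpa using hx
    | succ k ih => intro x hx; rw [pow_succ, Module.End.mul_apply]; exact ih _ (hgV x hx)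
  -- `w n` is the sum of all errors from time `n` on, pulled back to time `n`. It is chosen so that
  -- `f (w n) = δ n + w (n + 1)`; then `u n + w n` is an exact orbit of `f`, and the shadowing error
  -- is `-w n`.
  let w : ℕ → E := fun n => ∑' j, (g ^ (j + 1)) (δ (n + j))
  have hw : ∀ n, f (w n) = δ n + w (n + 1) := by
    intro n
    have h1 : f (w n) = ∑' j, f ((g ^ (j + 1)) (δ (n + j))) :=
      (LinearMap.toContinuousLinearMap f).map_tsum (hsum n)
    have h2 : ∀ j x, f ((g ^ (j + 1)) x) = (g ^ j) x := by
      intro j x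
      rw [pow_succ', Module.End.mul_apply, ← Module.End.mul_apply f g, hfg, Module.End.one_apply]
    simp only [h2] at h1
    have h3 : Summable fun j => (g ^ j) (δ (n + j)) := by
      have := (LinearMap.toContinuousLinearMap f).summable (hsum n)
      simpa [h2] using this
    rw [h1, h3.tsum_eq_zero_add]
    simp only [pow_zero, Module.End.one_apply, add_zero]
    congr 2
    ext j
    rw [add_right_comm, add_assoc]
  have hwV : w 0 ∈ V := by
    have hcl := Submodule.closed_of_finiteDimensional V
    exact hcl.mem_of_tendsto (hsum 0).hasSum
      (Filter.Eventually.of_forall fun s => V.sum_mem fun j _ => hgpow _ _ (hδ _))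
  refine ⟨u 0 + w 0, V.add_mem hu hwV, ∑' j, c (j + 1) * C, fun n => ?_⟩
  have hn : (f ^ n) (u 0 + w 0) = u n + w n := by
    induction n with
    | zero => simp
    | succ n ih =>
      rw [pow_succ', Module.End.mul_apply, ih, map_add, hw, h]
      abel
  rw [hn, sub_add_cancel_left, norm_neg]
  exact tsum_of_norm_bounded hc1.hasSum (hbd n)

/-- A common vector satisfies `‖x‖ = ‖g^n (f^n x)‖ ≤ c n * ‖f^n x‖`, and both factors tend to zero.
-/
theorem disjoint_of_summableOrbits {U : Submodule ℝ E} (hV : V ≤ summableOrbits f)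
    (hU : U ≤ summableOrbits g) (hgf : g * f = 1) (hfU : ∀ x ∈ U, f x ∈ U) : Disjoint V U := by
  rw [Submodule.disjoint_def]
  intro x hxV hxU
  obtain ⟨c, hc, hc0, hcb⟩ := exists_summable_bound hU
  have hfn : ∀ n, (f ^ n) x ∈ U := by
    intro n
    induction n with
    | zero => simpa using hxU
    | succ n ih => rw [pow_succ', Module.End.mul_apply]; exact hfU _ ih
  have hgf' : ∀ n, g ^ n * f ^ n = 1 := by
    intro n
    induction n with
    | zero => simp
    | succ n ih => rw [pow_succ, pow_succ', mul_assoc, ← mul_assoc g, hgf, one_mul, ih]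
  have h1 : ∀ n, ‖x‖ ≤ c n * ‖(f ^ n) x‖ := by
    intro n
    have := hcb _ (hfn n) n
    rwa [← Module.End.mul_apply, hgf', Module.End.one_apply] at this
  have h2 : Filter.Tendsto (fun n => c n * ‖(f ^ n) x‖) Filter.atTop (nhds (0 * 0)) :=
    hc.tendsto_atTop_zero.mul (Summable.tendsto_atTop_zero (hV hxV))
  rw [mul_zero] at h2
  have h3 := ge_of_tendsto' h2 h1
  exact norm_le_zero_iff.1 h3

/-- `‖D x‖ = ‖D (f^n x)‖` is independent of `n` and tends to zero. -/
theorem le_ker_of_summableOrbits {F : Type*} [NormedAddCommGroup F] [NormedSpace ℝ F]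
    {D : E →ₗ[ℝ] F} (hV : V ≤ summableOrbits f) (hD : ∀ x, ‖D (f x)‖ = ‖D x‖) :
    V ≤ LinearMap.ker D := by
  intro x hx
  obtain ⟨K, hK0, hK⟩ := D.exists_norm_le
  have h1 : ∀ n, ‖D x‖ ≤ K * ‖(f ^ n) x‖ := by
    intro n
    have : ‖D ((f ^ n) x)‖ = ‖D x‖ := by
      induction n with
      | zero => simp
      | succ n ih => rw [pow_succ', Module.End.mul_apply, hD, ih]
    rw [← this]
    exact hK _
  have h2 := (Summable.tendsto_atTop_zero (hV hx)).const_mul K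
  rw [mul_zero] at h2
  exact norm_le_zero_iff.1 (ge_of_tendsto' h2 h1)

/-- If `ω` satisfies a linear recurrence up to a bounded error and `D ω` is bounded, where `ker D` is
the sum of an expanded subspace `U` and a contracted subspace `V`, then `ω` remains at bounded distance
from the orbit of some vector of `U`. -/
theorem exists_orbit_of_recurrence {F : Type*} [NormedAddCommGroup F] [NormedSpace ℝ F]
    {D : E →ₗ[ℝ] F} {U : Submodule ℝ E} (hV : V ≤ summableOrbits f)
    (hU : U ≤ summableOrbits g) (hgf : g * f = 1) (hfg : f * g = 1)
    (hfV : ∀ x ∈ V, f x ∈ V) (hfU : ∀ x ∈ U, f x ∈ U) (hgU : ∀ x ∈ U, g x ∈ U)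
    (hD : ∀ x, ‖D (f x)‖ = ‖D x‖)
    (hdim : Module.finrank ℝ (LinearMap.ker D) ≤ Module.finrank ℝ U + Module.finrank ℝ V)
    {ω : ℕ → E} {C C' : ℝ} (hω : ∀ n, ‖ω (n + 1) - f (ω n)‖ ≤ C) (hDω : ∀ n, ‖D (ω n)‖ ≤ C') :
    ∃ v ∈ U, ∃ K, ∀ n, ‖ω n - (f ^ n) v‖ ≤ K := by
  have hdisj := disjoint_of_summableOrbits hV hU hgf hfU
  have hD' : ∀ x, ‖D (g x)‖ = ‖D x‖ := by
    intro x
    rw [← hD, ← Module.End.mul_apply, hfg, Module.End.one_apply]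
  have hVU : V ⊔ U = LinearMap.ker D := by
    refine Submodule.eq_of_le_of_finrank_le
      (sup_le (le_ker_of_summableOrbits hV hD) (le_ker_of_summableOrbits hU hD')) ?_
    have := Submodule.finrank_sup_add_finrank_inf_eq V U
    rw [hdisj.eq_bot, finrank_bot] at this
    omega
  -- The complement `W` of `V` is chosen to contain `U`, so that on `ker D = V ⊕ U` the map `P` is
  -- the projection to `V` along `U`. Outside `ker D` it need not commute with `f`.
  obtain ⟨W, hUW, hW⟩ := hdisj.symm.exists_isCompl
  -- A linear section of `D` over its range: `R = G ∘ D` satisfies `D ∘ R = D`. Hence `ω - R ω` lies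
  -- in `ker D`, and `R ω` is bounded because `D ω` is.
  obtain ⟨G, hG⟩ := D.rangeRestrict.exists_rightInverse_of_surjective D.range_rangeRestrict
  let P : E →ₗ[ℝ] E := V.subtype ∘ₗ V.projectionOnto W hW.symm
  let R : E →ₗ[ℝ] E := G ∘ₗ D.rangeRestrict
  have hPV : ∀ x ∈ V, P x = x := by
    intro x hx
    simpa [P] using congrArg Subtype.val (Submodule.projectionOnto_apply_left hW.symm ⟨x, hx⟩)
  have hPU : ∀ x ∈ U, P x = 0 := by
    intro x hx
    simp only [P, LinearMap.comp_apply, Submodule.subtype_apply]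
    rw [Submodule.coe_eq_zero, Submodule.projectionOnto_apply_eq_zero_iff]
    exact hUW hx
  have hPmem : ∀ x, P x ∈ V := fun x => Submodule.coe_mem _
  have hQmem : ∀ x ∈ LinearMap.ker D, x - P x ∈ U := by
    intro x hx
    rw [← hVU] at hx
    obtain ⟨s, hs, u, hu, rfl⟩ := Submodule.mem_sup.1 hx
    rw [map_add, hPV s hs, hPU u hu]
    simpa using hu
  have hPf : ∀ x ∈ LinearMap.ker D, P (f x) = f (P x) := by
    intro x hx
    rw [← hVU] at hx
    obtain ⟨s, hs, u, hu, rfl⟩ := Submodule.mem_sup.1 hx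
    rw [map_add, map_add, map_add, hPV s hs, hPU u hu, hPV _ (hfV s hs), hPU _ (hfU u hu)]
    simp
  have hfker : ∀ x ∈ LinearMap.ker D, f x ∈ LinearMap.ker D := by
    intro x hx
    rw [LinearMap.mem_ker] at hx ⊢
    rw [← norm_eq_zero, hD, hx, norm_zero]
  obtain ⟨KP, hKP0, hKP⟩ := P.exists_norm_le
  obtain ⟨Kf, hKf0, hKf⟩ := LinearMap.exists_norm_le f
  obtain ⟨KG, hKG0, hKG⟩ := G.exists_norm_le
  have hRω : ∀ n, ‖R (ω n)‖ ≤ KG * C' := fun n =>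
    (hKG _).trans (mul_le_mul_of_nonneg_left (hDω n) hKG0)
  let y : ℕ → E := fun n => ω n - R (ω n)
  have hy : ∀ n, y n ∈ LinearMap.ker D := by
    intro n
    have h1 := congrArg Subtype.val (LinearMap.congr_fun hG (D.rangeRestrict (ω n)))
    have h2 : D (R (ω n)) = D (ω n) := h1
    rw [LinearMap.mem_ker, map_sub, h2, sub_self]
  let δ : ℕ → E := fun n => y (n + 1) - f (y n)
  have hδker : ∀ n, δ n ∈ LinearMap.ker D := fun n => Submodule.sub_mem _ (hy _) (hfker _ (hy n))
  have hδ : ∀ n, ‖δ n‖ ≤ C + Kf * (KG * C') + KG * C' := by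
    intro n
    have h1 : δ n = (ω (n + 1) - f (ω n)) + f (R (ω n)) - R (ω (n + 1)) := by
      simp only [δ, y, map_sub]; abel
    rw [h1]
    refine (norm_sub_le _ _).trans (add_le_add ((norm_add_le _ _).trans
      (add_le_add (hω n) ?_)) (hRω _))
    exact (hKf _).trans (mul_le_mul_of_nonneg_left (hRω n) hKf0)
  have hrec : ∀ n, y (n + 1) = f (y n) + δ n := fun n => by simp [δ]
  obtain ⟨K1, hK1⟩ := bounded_of_stable_recurrence (s := fun n => P (y n)) (δ := fun n => P (δ n))
    (C := KP * (C + Kf * (KG * C') + KG * C')) hV (hPmem _) (fun n => hPmem _)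
    (fun n => (hKP _).trans (mul_le_mul_of_nonneg_left (hδ n) hKP0))
    (fun n => by simp only [hrec n, map_add, hPf _ (hy n)])
  obtain ⟨v, hv, K2, hK2⟩ := exists_orbit_of_unstable_recurrence (u := fun n => y n - P (y n))
    (δ := fun n => δ n - P (δ n))
    (C := (C + Kf * (KG * C') + KG * C') + KP * (C + Kf * (KG * C') + KG * C')) hU hfg hgU
    (hQmem _ (hy 0)) (fun n => hQmem _ (hδker n))
    (fun n => (norm_sub_le _ _).trans (add_le_add (hδ n)
      ((hKP _).trans (mul_le_mul_of_nonneg_left (hδ n) hKP0))))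
    (fun n => by simp only [hrec n, map_add, map_sub, hPf _ (hy n)]; abel)
  refine ⟨v, hv, KG * C' + K1 + K2, fun n => ?_⟩
  have h1 : ω n - (f ^ n) v = R (ω n) + P (y n) + (y n - P (y n) - (f ^ n) v) := by
    simp only [y]; abel
  rw [h1]
  exact (norm_add_le _ _).trans (add_le_add ((norm_add_le _ _).trans
    (add_le_add (hRω n) (hK1 n))) (hK2 n))

end Recurrence

/-! ### The parity of the number of vertices -/

/-- The sign is `-1` to the power (size of the support plus number of nontrivial cycles), so this
exponent is even. Each fixed point adds two to the total, once as a point and once as an orbit. -/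
theorem Equiv.Perm.even_card_add_card_orbits {X : Type*} [Fintype X] [DecidableEq X]
    (σ : Equiv.Perm X) (h : Equiv.Perm.sign σ = 1) :
    Even (Fintype.card X + Nat.card (Quotient (Equiv.Perm.SameCycle.setoid σ))) := by
  classical
  -- A complete invariant of the orbit of `x`: its cycle, or the point itself when fixed. The two
  -- kinds are counted separately because `cycleFactorsFinset` omits fixed points.
  let F : X → Equiv.Perm X ⊕ X := fun x => if σ x = x then Sum.inr x else Sum.inl (σ.cycleOf x)
  have hF : ∀ x y, F x = F y ↔ σ.SameCycle x y := by
    intro x y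
    simp only [F]
    by_cases hx : σ x = x <;> by_cases hy : σ y = y
    · simp only [hx, hy, if_true, Sum.inr.injEq]
      exact ⟨fun h => h ▸ Equiv.Perm.SameCycle.refl _ _, fun h => h.eq_of_left hx⟩
    · simp only [hx, hy, if_true, if_false, reduceCtorEq, false_iff]
      exact fun h => hy ((h.apply_eq_self_iff).1 hx)
    · simp only [hx, hy, if_true, if_false, reduceCtorEq, false_iff]
      exact fun h => hx ((h.apply_eq_self_iff).2 hy)
    · simp only [hx, hy, if_false, Sum.inl.injEq]
      refine ⟨fun h => ?_, fun h => h.cycleOf_eq⟩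
      have h1 : y ∈ (σ.cycleOf x).support := by
        rw [h, Equiv.Perm.mem_support_cycleOf_iff]
        exact ⟨Equiv.Perm.SameCycle.refl _ _, Equiv.Perm.mem_support.2 hy⟩
      exact (Equiv.Perm.mem_support_cycleOf_iff.1 h1).1
  have hcard : Nat.card (Quotient (Equiv.Perm.SameCycle.setoid σ)) =
      (Finset.univ.image F).card := by
    have e : Quotient (Equiv.Perm.SameCycle.setoid σ) ≃ Set.range F :=
      (Quotient.congrRight (fun x y => (hF x y).symm)).trans (Setoid.quotientKerEquivRange F)
    rw [Nat.card_congr e, Nat.card_eq_card_toFinset, Set.toFinset_range]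
  have himg : Finset.univ.image F = σ.cycleFactorsFinset.disjSum (σ.support)ᶜ := by
    ext (τ | x)
    · simp only [Finset.mem_image, Finset.mem_univ, true_and, Finset.inl_mem_disjSum, F]
      constructor
      · rintro ⟨x, hx⟩
        by_cases hx' : σ x = x
        · simp [hx'] at hx
        · simp only [hx', if_false, Sum.inl.injEq] at hx
          rw [← hx, Equiv.Perm.cycleOf_mem_cycleFactorsFinset_iff]
          exact Equiv.Perm.mem_support.2 hx'
      · intro hτ
        obtain ⟨x, hx⟩ := (Equiv.Perm.mem_cycleFactorsFinset_iff.1 hτ).1.nonempty_support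
        refine ⟨x, ?_⟩
        have h1 : σ x ≠ x :=
          Equiv.Perm.mem_support.1 (Equiv.Perm.mem_cycleFactorsFinset_support_le hτ hx)
        simp only [h1, if_false, Sum.inl.injEq]
        exact (Equiv.Perm.cycle_is_cycleOf hx hτ).symm
    · simp only [Finset.mem_image, Finset.mem_univ, true_and, Finset.inr_mem_disjSum,
        Finset.mem_compl, Equiv.Perm.mem_support, not_not, F]
      constructor
      · rintro ⟨y, hy⟩
        by_cases hy' : σ y = y
        · simp only [hy', if_true, Sum.inr.injEq] at hy
          rwa [← hy]
        · simp [hy'] at hy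
      · intro hx
        exact ⟨x, by simp [hx]⟩
  have h2 := Equiv.Perm.sign_of_cycleType σ
  rw [h, Equiv.Perm.sum_cycleType] at h2
  have h3 : Multiset.card σ.cycleType = σ.cycleFactorsFinset.card := by
    rw [Equiv.Perm.cycleType_def, Multiset.card_map]; rfl
  have h4 : Even (σ.support.card + Multiset.card σ.cycleType) := by
    by_contra hn
    rw [Nat.not_even_iff_odd] at hn
    rw [hn.neg_one_pow] at h2
    exact absurd h2 (by decide)
  have h5 := Finset.card_le_univ σ.support
  rw [hcard, himg, Finset.card_disjSum, Finset.card_compl, ← h3]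
  obtain ⟨m, hm⟩ := h4
  refine ⟨m + (Fintype.card X - σ.support.card), ?_⟩
  omega

/-! ### The vertices as orbits of an even permutation -/

namespace GIET

variable {d : ℕ} {r : ℕ∞}

/-- The bijection between top and bottom vertices `U_i ↦ V_j` given by sharing a left edge label,
with `U_d ↦ V_d`. -/
noncomputable def leftGlue (T : GIET d r) : Equiv.Perm (Fin (d + 1)) :=
  finSuccEquivLast.symm.permCongr (Equiv.optionCongr (T.permTop.trans T.permBot.symm))

/-- The bijection between top and bottom vertices `U_i ↦ V_j` given by sharing a right edge label,
with `U_0 ↦ V_0`. -/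
noncomputable def rightGlue (T : GIET d r) : Equiv.Perm (Fin (d + 1)) :=
  (finSuccEquiv d).symm.permCongr (Equiv.optionCongr (T.permTop.trans T.permBot.symm))

theorem leftGlue_castSucc (T : GIET d r) (i : Fin d) :
    T.leftGlue i.castSucc = (T.permBot.symm (T.permTop i)).castSucc := by
  simp [leftGlue, Equiv.permCongr_apply, -Equiv.optionCongr_trans]

theorem leftGlue_last (T : GIET d r) : T.leftGlue (Fin.last d) = Fin.last d := by
  simp [leftGlue, Equiv.permCongr_apply, -Equiv.optionCongr_trans]

theorem rightGlue_succ (T : GIET d r) (i : Fin d) :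
    T.rightGlue i.succ = (T.permBot.symm (T.permTop i)).succ := by
  simp [rightGlue, Equiv.permCongr_apply, -Equiv.optionCongr_trans]

theorem rightGlue_zero (T : GIET d r) : T.rightGlue 0 = 0 := by
  simp [rightGlue, Equiv.permCongr_apply, -Equiv.optionCongr_trans]

theorem vertexGlued_leftGlue (T : GIET d r) (i : Fin (d + 1)) :
    T.VertexGlued (Sum.inl i) (Sum.inr (T.leftGlue i)) := by
  induction i using Fin.lastCases with
  | last => rw [leftGlue_last]; exact .last
  | cast i => rw [leftGlue_castSucc]; exact .left _ _ (by simp)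

theorem vertexGlued_rightGlue (T : GIET d r) (i : Fin (d + 1)) :
    T.VertexGlued (Sum.inl i) (Sum.inr (T.rightGlue i)) := by
  induction i using Fin.cases with
  | zero => rw [rightGlue_zero]; exact .first
  | succ i => rw [rightGlue_succ]; exact .right _ _ (by simp)

theorem vertexGlued_iff (T : GIET d r) {x y : Fin (d + 1) ⊕ Fin (d + 1)} (h : T.VertexGlued x y) :
    ∃ i, x = Sum.inl i ∧ (y = Sum.inr (T.leftGlue i) ∨ y = Sum.inr (T.rightGlue i)) := by
  cases h with
  | first => exact ⟨0, rfl, Or.inr (by rw [rightGlue_zero])⟩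
  | last => exact ⟨Fin.last d, rfl, Or.inl (by rw [leftGlue_last])⟩
  | left i j h => exact ⟨_, rfl, Or.inl (by rw [leftGlue_castSucc, h, Equiv.symm_apply_apply])⟩
  | right i j h => exact ⟨_, rfl, Or.inr (by rw [rightGlue_succ, h, Equiv.symm_apply_apply])⟩

/-- Every gluing joins `U_i` to `V_{leftGlue i}` or to `V_{rightGlue i}`. Eliminating the bottom
vertices leaves the top ones, with `i` identified with `leftGlue⁻¹ (rightGlue i)`. -/
theorem numSing_eq (T : GIET d r) : T.numSing =
    Nat.card (Quotient (Equiv.Perm.SameCycle.setoid (T.leftGlue⁻¹ * T.rightGlue))) := by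
  set σ := T.leftGlue⁻¹ * T.rightGlue with hσ
  have hmk : ∀ i, (Quot.mk T.VertexGlued (Sum.inl (σ i))) = Quot.mk _ (Sum.inl i) := by
    intro i
    rw [Quot.sound (T.vertexGlued_leftGlue (σ i)), Quot.sound (T.vertexGlued_rightGlue i)]
    simp [hσ]
  have hpow : ∀ (n : ℕ) i, (Quot.mk T.VertexGlued (Sum.inl ((σ ^ n) i))) =
      Quot.mk _ (Sum.inl i) := by
    intro n
    induction n with
    | zero => simp
    | succ n ih => intro i; rw [pow_succ', Equiv.Perm.mul_apply, hmk, ih]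
  refine Nat.card_congr ⟨Quot.lift (Sum.elim (fun i => Quotient.mk _ i)
    (fun j => Quotient.mk _ (T.leftGlue⁻¹ j))) ?_,
    Quotient.lift (fun i => Quot.mk _ (Sum.inl i)) ?_, ?_, ?_⟩
  · intro x y hxy
    obtain ⟨i, rfl, rfl | rfl⟩ := T.vertexGlued_iff hxy
    · simp
    · exact Quotient.sound (Equiv.Perm.sameCycle_apply_right.2 (Equiv.Perm.SameCycle.refl σ i))
  · intro i j hij
    obtain ⟨n, -, -, hn⟩ := Equiv.Perm.SameCycle.exists_pow_eq σ hij
    rw [← hn]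
    exact (hpow n i).symm
  · rintro ⟨i | j⟩
    · rfl
    · refine (Quot.sound (T.vertexGlued_leftGlue (T.leftGlue⁻¹ j))).trans ?_
      simp
  · rintro ⟨i⟩
    rfl

/-- Both gluings are conjugate to the same permutation extended by one fixed point, so they have
equal signs and their quotient is even. -/
theorem even_numSing (T : GIET d r) : Even (d + 1 + T.numSing) := by
  rw [numSing_eq]
  have h := Equiv.Perm.even_card_add_card_orbits (T.leftGlue⁻¹ * T.rightGlue) (by
    rw [map_mul, map_inv, leftGlue, rightGlue, Equiv.Perm.sign_permCongr,
      Equiv.Perm.sign_permCongr, inv_mul_cancel])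
  rwa [Fintype.card_fin] at h

end GIET

/-! ### Labellings of end points by vertices -/

namespace IsIntervalPartition

variable {d : ℕ} {L : ℝ} {a b : Fin d → ℝ}

theorem separated (h : IsIntervalPartition L a b) {i j : Fin d} (hij : i ≠ j) :
    b i ≤ a j ∨ b j ≤ a i := by
  by_contra hn
  push Not at hn
  have h1 := h.lt i
  have h2 := h.lt j
  exact Set.disjoint_left.1 (h.disj i j hij)
    (⟨le_max_left _ _, max_lt h1 hn.1⟩ : max (a i) (a j) ∈ Ico (a i) (b i))
    ⟨le_max_right _ _, max_lt hn.2 h2⟩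

theorem left_injective (h : IsIntervalPartition L a b) : Function.Injective a := by
  intro i j hij
  by_contra hne
  have h1 := h.lt i
  have h2 := h.lt j
  rcases h.separated hne with h3 | h3 <;> linarith

theorem right_sort (h : IsIntervalPartition L a b) {k k' : Fin d} (hk : k.val + 1 = k'.val) :
    b (Tuple.sort a k) = a (Tuple.sort a k') := by
  have hmono := Tuple.monotone_sort a
  have hkk : k < k' := Fin.lt_def.2 (by omega)
  have hne : Tuple.sort a k ≠ Tuple.sort a k' := fun h => hkk.ne ((Tuple.sort a).injective h)
  have h1 : a (Tuple.sort a k) ≤ a (Tuple.sort a k') := hmono hkk.le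
  have h2 := h.lt (Tuple.sort a k)
  have h2' := h.lt (Tuple.sort a k')
  have h3 : b (Tuple.sort a k) ≤ a (Tuple.sort a k') := by
    rcases h.separated hne with h3 | h3
    · exact h3
    · linarith
  -- A gap would put the right end of the `k`-th interval inside some interval `m`. It cannot come
  -- at or after `k'`, since those start too late; and at or before `k`, being different from the
  -- `k`-th, it ends too early.
  refine h3.antisymm (not_lt.1 fun h4 => ?_)
  obtain ⟨m, hm⟩ := h.exists_mem (x := b (Tuple.sort a k))
    ⟨(h.nonneg_and_le _).1.trans h2.le, by linarith [(h.nonneg_and_le (Tuple.sort a k')).2]⟩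
  have hmk : (Tuple.sort a).symm m ≤ k := by
    by_contra hn
    have h5 : k' ≤ (Tuple.sort a).symm m := Fin.le_def.2 (by
      have := Fin.lt_def.1 (not_le.1 hn); omega)
    have h6 : a (Tuple.sort a k') ≤ a (Tuple.sort a ((Tuple.sort a).symm m)) := hmono h5
    rw [Equiv.apply_symm_apply] at h6
    linarith [hm.1]
  have h7 : a (Tuple.sort a ((Tuple.sort a).symm m)) ≤ a (Tuple.sort a k) := hmono hmk
  rw [Equiv.apply_symm_apply] at h7
  have hne' : m ≠ Tuple.sort a k := by
    rintro rfl
    exact lt_irrefl _ hm.2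
  rcases h.separated hne' with h8 | h8
  · linarith [hm.2]
  · linarith

theorem left_sort_zero (h : IsIntervalPartition L a b) (hL : 0 < L) {k : Fin d}
    (hk : k.val = 0) : a (Tuple.sort a k) = 0 := by
  obtain ⟨m, hm⟩ := h.exists_mem (x := 0) ⟨le_rfl, hL⟩
  have h1 : a (Tuple.sort a k) ≤ a (Tuple.sort a ((Tuple.sort a).symm m)) :=
    Tuple.monotone_sort a (Fin.le_def.2 (by omega))
  rw [Equiv.apply_symm_apply] at h1
  exact le_antisymm (h1.trans hm.1) (h.nonneg_and_le _).1

/-- If an interval ends where another one starts, then they are adjacent in the ordering. -/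
theorem succ_eq_of_right_eq_left (h : IsIntervalPartition L a b) {i j : Fin d} (hij : b i = a j) :
    ((Tuple.sort a).symm i).succ = ((Tuple.sort a).symm j).castSucc := by
  by_cases hk : ((Tuple.sort a).symm i).val + 1 < d
  · have h1 := h.right_sort (k := (Tuple.sort a).symm i) (k' := ⟨_, hk⟩) rfl
    rw [Equiv.apply_symm_apply, hij] at h1
    have h2 := h.left_injective h1
    rw [h2, Equiv.symm_apply_apply]
    ext
    simp
  · exfalso
    have hd := (h.lt j).trans_le (h.nonneg_and_le j).2
    have h1 := h.last_sort ((h.nonneg_and_le j).1.trans_lt hd) ((Tuple.sort a).symm i)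
      (fun m => Fin.le_def.2 (by omega))
    rw [Equiv.apply_symm_apply] at h1
    linarith

theorem symm_sort_zero (h : IsIntervalPartition L a b) {i : Fin d} (hi : a i = 0) :
    ((Tuple.sort a).symm i).castSucc = 0 := by
  have hd := (h.lt i).trans_le (h.nonneg_and_le i).2
  have h1 := h.left_sort_zero ((h.nonneg_and_le i).1.trans_lt hd) (k := ⟨0, i.pos⟩) rfl
  rw [← hi] at h1
  rw [← h.left_injective h1, Equiv.symm_apply_apply]
  rfl

theorem symm_sort_last (h : IsIntervalPartition L a b) {i : Fin d} (hi : b i = L) :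
    ((Tuple.sort a).symm i).succ = Fin.last d := by
  by_contra hn
  have hk : ((Tuple.sort a).symm i).val + 1 < d := by
    by_contra hk
    exact hn (Fin.ext (by simp; omega))
  have h1 := h.right_sort (k := (Tuple.sort a).symm i) (k' := ⟨_, hk⟩) rfl
  rw [Equiv.apply_symm_apply, hi] at h1
  have h2 := h.lt (Tuple.sort a ⟨_, hk⟩)
  have h3 := (h.nonneg_and_le (Tuple.sort a ⟨_, hk⟩)).2
  linarith

end IsIntervalPartition

/-- `l i` and `r i` label the left and right end points of the `i`-th intervals of two partitions of
`[0, L)`; end points that are glued to the same vertex have the same label, and all labels occur. -/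
structure IsVertexLabelling {d : ℕ} {Q : Type*} (L : ℝ) (a b c e : Fin d → ℝ) (l r : Fin d → Q) :
    Prop where
  top : ∀ i j, b i = a j → r i = l j
  bot : ∀ i j, e i = c j → r i = l j
  first : ∀ i j, a i = 0 → c j = 0 → l i = l j
  last : ∀ i j, b i = L → e j = L → r i = r j
  exists_eq : ∀ q, ∃ i, l i = q ∨ r i = q

namespace IsVertexLabelling

variable {d : ℕ} {Q : Type*} {L : ℝ} {a b c e : Fin d → ℝ} {l r : Fin d → Q}

/-- The axioms are symmetric in top and bottom, so a step won by the bottom reduces to one won by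
the top. -/
theorem swap (h : IsVertexLabelling L a b c e l r) : IsVertexLabelling L c e a b l r :=
  ⟨h.bot, h.top, fun i j hi hj => (h.first j i hj hi).symm,
    fun i j hi hj => (h.last j i hj hi).symm, h.exists_eq⟩

theorem rescale (h : IsVertexLabelling L a b c e l r) (hL : 0 < L) :
    IsVertexLabelling 1 (fun i => a i / L) (fun i => b i / L) (fun i => c i / L)
      (fun i => e i / L) l r := by
  have h1 : ∀ x y : ℝ, x / L = y / L ↔ x = y := fun x y => div_left_inj' hL.ne'
  have h2 : ∀ x : ℝ, x / L = 0 ↔ x = 0 := fun x => by simp [hL.ne']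
  have h3 : ∀ x : ℝ, x / L = 1 ↔ x = L := fun x => div_eq_one_iff_eq hL.ne'
  exact ⟨fun i j hij => h.top i j ((h1 _ _).1 hij), fun i j hij => h.bot i j ((h1 _ _).1 hij),
    fun i j hi hj => h.first i j ((h2 _).1 hi) ((h2 _).1 hj),
    fun i j hi hj => h.last i j ((h3 _).1 hi) ((h3 _).1 hj), h.exists_eq⟩

/-- The vertex labelling after an elementary step of Rauzy-Veech induction, won by `α`. -/
theorem step (h : IsVertexLabelling L a b c e l r) (ht : IsIntervalPartition L a b)
    (hb : IsIntervalPartition L c e) {α β : Fin d} (hα : b α = L) (hβ : e β = L) (hne : α ≠ β)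
    (hlt : a α < c β) {p : ℝ} (hp1 : c α < p) (hp2 : p < e α) :
    IsVertexLabelling (c β) a (Function.update b α (c β)) (Function.update c β p)
      (Function.update (Function.update e β (e α)) α p) l (Function.update r α (l β)) := by
  have hcL : c β < L := hβ ▸ hb.lt β
  have hrr : r α = r β := h.last α β hα hβ
  have hαβ : e α ≤ c β := hb.le_of_last hβ hne
  refine ⟨fun i j hij => ?_, fun i j hij => ?_, fun i j hi hj => ?_, fun i j hi hj => ?_,
    fun q => ?_⟩
  · rcases eq_or_ne i α with rfl | hi
    · simp only [Function.update_self] at hij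
      exfalso
      rcases eq_or_ne j i with rfl | hj
      · exact hlt.ne hij.symm
      · have := ht.le_of_last hα hj
        have := ht.lt j
        linarith
    · simp only [Function.update_of_ne hi] at hij ⊢
      exact h.top i j hij
  · rcases eq_or_ne i α with rfl | hi
    · simp only [Function.update_self] at hij ⊢
      rcases eq_or_ne j β with rfl | hj
      · rfl
      · exfalso
        rw [Function.update_of_ne hj] at hij
        rcases eq_or_ne j i with rfl | hji
        · exact hp1.ne hij.symm
        · have := hb.lt j
          rcases hb.separated hji with h1 | h1 <;> linarith
    · rw [Function.update_of_ne hi] at hij ⊢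
      rcases eq_or_ne i β with rfl | hiβ
      · rw [Function.update_self] at hij
        rcases eq_or_ne j i with rfl | hj
        · rw [Function.update_self] at hij
          linarith
        · rw [Function.update_of_ne hj] at hij
          rw [← hrr]
          exact h.bot _ _ hij
      · rw [Function.update_of_ne hiβ] at hij
        rcases eq_or_ne j β with rfl | hj
        · exfalso
          rw [Function.update_self] at hij
          have := hb.lt i
          rcases hb.separated hi with h1 | h1 <;> linarith
        · rw [Function.update_of_ne hj] at hij
          exact h.bot _ _ hij
  · rcases eq_or_ne j β with rfl | hj'
    · rw [Function.update_self] at hj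
      have := (hb.nonneg_and_le α).1
      linarith
    · rw [Function.update_of_ne hj'] at hj
      exact h.first i j hi hj
  · have hiα : i = α := by
      by_contra hi'
      rw [Function.update_of_ne hi'] at hi
      have := ht.le_of_last hα hi'
      linarith
    subst hiα
    rw [Function.update_self]
    rcases eq_or_ne j i with rfl | hji
    · rw [Function.update_self]
    · rw [Function.update_of_ne hji] at hj ⊢
      rcases eq_or_ne j β with rfl | hjβ
      · rw [Function.update_self] at hj
        rw [← hrr]
        exact (h.bot _ _ hj).symm
      · rw [Function.update_of_ne hjβ] at hj
        exact (h.bot _ _ hj).symm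
  · obtain ⟨i, hi | hi⟩ := h.exists_eq q
    · exact ⟨i, Or.inl hi⟩
    -- The label overwritten at `α` is not lost: both last intervals end at the same vertex, so `β`
    -- still carries it on the right.
    · rcases eq_or_ne i α with rfl | hiα
      · refine ⟨β, Or.inr ?_⟩
        rw [Function.update_of_ne hne.symm, ← hrr, hi]
      · exact ⟨i, Or.inr (by rw [Function.update_of_ne hiα, hi])⟩

end IsVertexLabelling

/-! ### Transport of vertex labellings by Rauzy–Veech induction -/

namespace GIET

variable {d : ℕ} {r : ℕ∞} {Q : Type*}

/-- A labelling of the end points of the intervals of `T` which is compatible with the gluing of the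
vertices of the suspension. -/
def IsLabelling (T : GIET d r) (l m : Fin d → Q) : Prop :=
  IsVertexLabelling 1 T.topL T.topR T.botL T.botR l m

theorem rauzyVeech_of_topWins {T : GIET d r} (h : T.IsRenormalizable) (hw : T.TopWins) :
    T.rauzyVeech = T.stepTop h hw := by
  rw [rauzyVeech, dif_pos h, dif_pos hw]

theorem rauzyVeech_of_not_topWins {T : GIET d r} (h : T.IsRenormalizable) (hw : ¬ T.TopWins) :
    T.rauzyVeech = T.stepBot h hw := by
  rw [rauzyVeech, dif_pos h, dif_neg hw]

section TopWins

variable {T : GIET d r}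

theorem cutPoint_of_topWins (hw : T.TopWins) : T.cutPoint = T.botL T.lastBot :=
  max_eq_right (le_of_lt hw)

theorem topL_lt_cutPoint (hw : T.TopWins) : T.topL T.lastTop < T.cutPoint := by
  rw [cutPoint_of_topWins hw]; exact hw

theorem cutPoint_lt_one (T : GIET d r) : T.cutPoint < 1 := by
  have h1 := T.isGIET.bot.lt T.lastBot
  have h2 := T.isGIET.top.lt T.lastTop
  rw [T.botR_lastBot] at h1
  rw [T.topR_lastTop] at h2
  exact max_lt h2 h1

theorem cutPoint_mem_of_topWins (hw : T.TopWins) :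
    T.cutPoint ∈ Ico (T.topL T.lastTop) (T.topR T.lastTop) :=
  ⟨(topL_lt_cutPoint hw).le, by rw [topR_lastTop]; exact T.cutPoint_lt_one⟩

theorem botL_lt_apply_cutPoint (hw : T.TopWins) : T.botL T.lastTop < T.toFun T.cutPoint := by
  have h0 : T.topL T.lastTop ∈ Ico (T.topL T.lastTop) (T.topR T.lastTop) :=
    ⟨le_rfl, T.isGIET.top.lt _⟩
  exact (T.isGIET.mem_bot h0).1.trans_lt
    (T.isGIET.strictMonoOn _ h0 (cutPoint_mem_of_topWins hw) (topL_lt_cutPoint hw))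

theorem apply_cutPoint_lt_botR (hw : T.TopWins) : T.toFun T.cutPoint < T.botR T.lastTop :=
  (T.isGIET.mem_bot (cutPoint_mem_of_topWins hw)).2

end TopWins

section BotWins

variable {T : GIET d r}

theorem cutPoint_of_not_topWins (hw : ¬ T.TopWins) : T.cutPoint = T.topL T.lastTop :=
  max_eq_left (not_lt.1 hw)

theorem botL_lt_cutPoint (h : T.IsRenormalizable) (hw : ¬ T.TopWins) :
    T.botL T.lastBot < T.cutPoint := by
  rw [cutPoint_of_not_topWins hw]; exact lt_of_le_of_ne (not_lt.1 hw) h.2.symm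

theorem exists_cutPreimage (hw : ¬ T.TopWins) :
    ∃ x ∈ Ico (T.topL T.lastBot) (T.topR T.lastBot), T.toFun x = T.cutPoint := by
  refine T.isGIET.exists_preimage ⟨?_, by rw [T.botR_lastBot]; exact T.cutPoint_lt_one⟩
  rw [cutPoint_of_not_topWins hw]
  exact not_lt.1 hw

theorem cutPreimage_mem (hw : ¬ T.TopWins) :
    T.cutPreimage ∈ Ico (T.topL T.lastBot) (T.topR T.lastBot) :=
  Function.invFunOn_mem (exists_cutPreimage hw)

theorem apply_cutPreimage (hw : ¬ T.TopWins) : T.toFun T.cutPreimage = T.cutPoint :=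
  Function.invFunOn_eq (exists_cutPreimage hw)

theorem topL_lt_cutPreimage (h : T.IsRenormalizable) (hw : ¬ T.TopWins) :
    T.topL T.lastBot < T.cutPreimage := by
  refine lt_of_le_of_ne (cutPreimage_mem hw).1 fun hq => ?_
  obtain ⟨g, hg, hfg⟩ := T.isGIET.branch T.lastBot
  have h1 := apply_cutPreimage hw
  rw [hfg (cutPreimage_mem hw), ← hq, hg.map_left] at h1
  exact (botL_lt_cutPoint h hw).ne h1

end BotWins

/-- Left ends keep their vertices. Among right ends only the winner's changes vertex: its interval
is shortened, and its new right end is the vertex at the left of the loser. -/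
theorem IsLabelling.rauzyVeech {T : GIET d r} {l m : Fin d → Q} (hl : T.IsLabelling l m)
    (h : T.IsRenormalizable) :
    T.rauzyVeech.IsLabelling l (Function.update m T.winner (l T.loser)) := by
  by_cases hw : T.TopWins
  · rw [rauzyVeech_of_topWins h hw, winner, loser, if_pos hw, if_pos hw]
    have hpos := T.cutPoint_pos h
    have hc := cutPoint_of_topWins hw
    have h1 := IsVertexLabelling.step hl T.isGIET.top T.isGIET.bot T.topR_lastTop T.botR_lastBot
      h.1 hw (botL_lt_apply_cutPoint hw) (apply_cutPoint_lt_botR hw)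
    rw [← hc] at h1
    exact h1.rescale hpos
  · rw [rauzyVeech_of_not_topWins h hw, winner, loser, if_neg hw, if_neg hw]
    have hpos := T.cutPoint_pos h
    have hc := cutPoint_of_not_topWins hw
    have hlt := botL_lt_cutPoint h hw
    rw [hc] at hlt
    have h1 := IsVertexLabelling.step (IsVertexLabelling.swap hl) T.isGIET.bot T.isGIET.top
      T.botR_lastBot T.topR_lastTop h.1.symm hlt (topL_lt_cutPreimage h hw) (cutPreimage_mem hw).2
    rw [← hc] at h1
    exact (h1.rescale hpos).swap

/-- The vertex of the left end point of the edge with label `i`. -/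
noncomputable def leftVertex (T : GIET d r) (i : Fin d) : Quot T.VertexGlued :=
  Quot.mk _ (Sum.inl (T.permTop.symm i).castSucc)

/-- The vertex of the right end point of the edge with label `i`. -/
noncomputable def rightVertex (T : GIET d r) (i : Fin d) : Quot T.VertexGlued :=
  Quot.mk _ (Sum.inl (T.permTop.symm i).succ)

theorem leftVertex_eq (T : GIET d r) (i : Fin d) :
    T.leftVertex i = Quot.mk _ (Sum.inr (T.permBot.symm i).castSucc) :=
  Quot.sound (.left _ _ (by simp))

theorem rightVertex_eq (T : GIET d r) (i : Fin d) :
    T.rightVertex i = Quot.mk _ (Sum.inr (T.permBot.symm i).succ) :=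
  Quot.sound (.right _ _ (by simp))

theorem exists_inl_eq (T : GIET d r) (q : Quot T.VertexGlued) :
    ∃ i, Quot.mk T.VertexGlued (Sum.inl i) = q := by
  obtain ⟨i | j, rfl⟩ := q.exists_rep
  · exact ⟨i, rfl⟩
  · refine ⟨T.leftGlue.symm j, (Quot.sound (T.vertexGlued_leftGlue _)).trans ?_⟩
    rw [Equiv.apply_symm_apply]

theorem isLabelling_vertex (T : GIET d r) : T.IsLabelling T.leftVertex T.rightVertex := by
  refine ⟨fun i j hij => ?_, fun i j hij => ?_, fun i j hi hj => ?_, fun i j hi hj => ?_,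
    fun q => ?_⟩
  · have := T.isGIET.top.succ_eq_of_right_eq_left hij
    rw [rightVertex, leftVertex, permTop, this]
  · have := T.isGIET.bot.succ_eq_of_right_eq_left hij
    rw [rightVertex_eq, leftVertex_eq, permBot, this]
  · rw [leftVertex, permTop, T.isGIET.top.symm_sort_zero hi, leftVertex_eq, permBot,
      T.isGIET.bot.symm_sort_zero hj]
    exact Quot.sound .first
  · rw [rightVertex, permTop, T.isGIET.top.symm_sort_last hi, rightVertex_eq, permBot,
      T.isGIET.bot.symm_sort_last hj]
    exact Quot.sound .last
  · obtain ⟨i, rfl⟩ := T.exists_inl_eq q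
    induction i using Fin.lastCases with
    | last =>
      refine ⟨T.lastTop, Or.inr ?_⟩
      rw [rightVertex, permTop, T.isGIET.top.symm_sort_last T.topR_lastTop]
    | cast i => exact ⟨T.permTop i, Or.inl (by rw [leftVertex, Equiv.symm_apply_apply])⟩

/-- The labelling by vertices is universal among the labellings for given combinatorial data. -/
theorem IsLabelling.exists_factor {T T' : GIET d r} {l m : Fin d → Q} (hl : T'.IsLabelling l m)
    (ht : T'.permTop = T.permTop) (hb : T'.permBot = T.permBot) :
    ∃ φ : Quot T.VertexGlued → Q, Function.Surjective φ ∧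
      (∀ i, l i = φ (T.leftVertex i)) ∧ ∀ i, m i = φ (T.rightVertex i) := by
  have hlast : ∀ i : Fin d, i.succ = Fin.last d → i = T.lastPos := by
    intro i hi
    have := congrArg Fin.val hi
    exact Fin.ext (by simp [lastPos] at this ⊢; omega)
  -- A vertex of the polygon receives the left label of the side that starts there. No side starts
  -- at the last vertex, which takes the right label of the last side. `F` does this for the top
  -- vertices and `G` for the bottom ones.
  let F : Fin (d + 1) → Q :=
    Fin.lastCases (m (T'.permTop T.lastPos)) (fun i => l (T'.permTop i))
  let G : Fin (d + 1) → Q :=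
    Fin.lastCases (m (T'.permBot T.lastPos)) (fun i => l (T'.permBot i))
  have hFc : ∀ i, F (Fin.castSucc i) = l (T'.permTop i) := fun i => by simp [F]
  have hGc : ∀ i, G (Fin.castSucc i) = l (T'.permBot i) := fun i => by simp [G]
  have hFl : F (Fin.last d) = m (T'.permTop T.lastPos) := by simp [F]
  have hGl : G (Fin.last d) = m (T'.permBot T.lastPos) := by simp [G]
  have hFs : ∀ i, F (Fin.succ i) = m (T'.permTop i) := by
    intro i
    by_cases hi : i.succ = Fin.last d
    · rw [hi, hFl, hlast i hi]
    · have hi' : i.val + 1 < d := by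
        by_contra hn; exact hi (Fin.ext (by simp; omega))
      have h1 : i.succ = Fin.castSucc ⟨i.val + 1, hi'⟩ := by ext; simp
      rw [h1, hFc]
      exact (hl.top _ _ (T'.isGIET.top.right_sort rfl)).symm
  have hGs : ∀ i, G (Fin.succ i) = m (T'.permBot i) := by
    intro i
    by_cases hi : i.succ = Fin.last d
    · rw [hi, hGl, hlast i hi]
    · have hi' : i.val + 1 < d := by
        by_contra hn; exact hi (Fin.ext (by simp; omega))
      have h1 : i.succ = Fin.castSucc ⟨i.val + 1, hi'⟩ := by ext; simp
      rw [h1, hGc]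
      exact (hl.bot _ _ (T'.isGIET.bot.right_sort rfl)).symm
  have hglue : ∀ x y, T.VertexGlued x y → Sum.elim F G x = Sum.elim F G y := by
    intro x y hxy
    cases hxy with
    | first =>
      have hd : 0 < d := by have := T.two_le; omega
      have h0 : (0 : Fin (d + 1)) = Fin.castSucc ⟨0, hd⟩ := rfl
      simp only [Sum.elim_inl, Sum.elim_inr]
      rw [h0, hFc, hGc]
      exact hl.first _ _ (T'.isGIET.top.left_sort_zero one_pos rfl)
        (T'.isGIET.bot.left_sort_zero one_pos rfl)
    | last =>
      simp only [Sum.elim_inl, Sum.elim_inr]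
      rw [hFl, hGl]
      exact hl.last _ _ T'.topR_lastTop T'.botR_lastBot
    | left i j h =>
      simp only [Sum.elim_inl, Sum.elim_inr]
      rw [hFc, hGc, ht, hb, h]
    | right i j h =>
      simp only [Sum.elim_inl, Sum.elim_inr]
      rw [hFs, hGs, ht, hb, h]
  have h1 : ∀ i, l i = Quot.lift (Sum.elim F G) hglue (T.leftVertex i) := by
    intro i
    change _ = F _
    rw [hFc, ht, Equiv.apply_symm_apply]
  have h2 : ∀ i, m i = Quot.lift (Sum.elim F G) hglue (T.rightVertex i) := by
    intro i
    change _ = F _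
    rw [hFs, ht, Equiv.apply_symm_apply]
  refine ⟨Quot.lift (Sum.elim F G) hglue, fun q => ?_, h1, h2⟩
  obtain ⟨i, rfl | rfl⟩ := hl.exists_eq q
  · exact ⟨T.leftVertex i, (h1 i).symm⟩
  · exact ⟨T.rightVertex i, (h2 i).symm⟩

end GIET

/-! ### The boundary of a vector -/

section Boundary

variable {d : ℕ} {Q Q' : Type*}

open Classical in
/-- The boundary of a chain of edges, where the edge `i` runs from `l i` (with weight `x i`) to `m i`
(with weight `y i`). -/
noncomputable def boundary (l m : Fin d → Q) (x y : Fin d → ℝ) : Q → ℝ :=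
  ∑ i, (Pi.single (l i) (x i) - Pi.single (m i) (y i))

open Classical in
/-- The boundary operator `∑ wᵢ ([l i] - [m i])`. -/
noncomputable def boundaryMap (l m : Fin d → Q) : (Fin d → ℝ) →ₗ[ℝ] (Q → ℝ) :=
  ∑ i, (LinearMap.single ℝ (fun _ => ℝ) (l i) - LinearMap.single ℝ (fun _ => ℝ) (m i)) ∘ₗ
    LinearMap.proj i

theorem boundaryMap_apply (l m : Fin d → Q) (w : Fin d → ℝ) :
    boundaryMap l m w = boundary l m w w := by
  simp [boundaryMap, boundary]

theorem boundary_comp_equiv (φ : Q ≃ Q') (l m : Fin d → Q) (x y : Fin d → ℝ) :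
    boundary (φ ∘ l) (φ ∘ m) x y = boundary l m x y ∘ φ.symm := by
  classical
  ext q
  have h : ∀ u, q = φ u ↔ φ.symm q = u := fun u => φ.symm_apply_eq.symm
  simp only [boundary, Finset.sum_apply, Pi.sub_apply, Pi.single_apply, Function.comp_apply]
  exact Finset.sum_congr rfl fun i _ =>
    congrArg₂ _ (by simp only [h]) (by simp only [h])

theorem boundary_sub (l m : Fin d → Q) (x y x' y' : Fin d → ℝ) :
    boundary l m x y - boundary l m x' y' = boundary l m (x - x') (y - y') := by
  simp only [boundary, ← Finset.sum_sub_distrib, Pi.sub_apply, Pi.single_sub]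
  exact Finset.sum_congr rfl fun i _ => by abel

variable [Fintype Q] [Fintype Q']

theorem norm_comp_equiv (φ : Q ≃ Q') (f : Q → ℝ) : ‖f ∘ φ.symm‖ = ‖f‖ := by
  simp only [Pi.norm_def, Function.comp_apply]
  congr 1
  refine le_antisymm (Finset.sup_le fun i _ => ?_) (Finset.sup_le fun i _ => ?_)
  · exact Finset.le_sup (f := fun i => ‖f i‖₊) (Finset.mem_univ (φ.symm i))
  · have := Finset.le_sup (f := fun i => ‖f (φ.symm i)‖₊) (Finset.mem_univ (φ i))
    simpa using this

theorem norm_boundary_le {l m : Fin d → Q} {x y : Fin d → ℝ} {C : ℝ} (hx : ∀ i, |x i| ≤ C)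
    (hy : ∀ i, |y i| ≤ C) : ‖boundary l m x y‖ ≤ d * (C + C) := by
  classical
  have hs : ∀ (q : Q) (t : ℝ), ‖(Pi.single q t : Q → ℝ)‖ ≤ |t| := by
    intro q t
    refine (pi_norm_le_iff_of_nonneg (abs_nonneg t)).2 fun i => ?_
    rw [Pi.single_apply]
    split_ifs <;> simp
  rw [boundary]
  refine (norm_sum_le _ _).trans ?_
  refine (Finset.sum_le_sum (g := fun _ => C + C) fun i _ => ?_).trans (by simp [mul_add])
  refine (norm_sub_le _ _).trans (add_le_add ?_ ?_)
  · convert (hs _ _).trans (hx i)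
  · convert (hs _ _).trans (hy i)

end Boundary

/-- Winner and loser end at the same vertex. The new edge `w` ends at `l s`, where `x' s - y' w`
must equal the old weight `x s`, and `y' s` must take over the weight of both edges at the old
common end. Separate weights for the two ends let this one computation serve the matrix `Z(T)` and
the end point values of `log DT` alike. -/
theorem boundary_update {d : ℕ} {Q : Type*} {l m : Fin d → Q} {x y x' y' : Fin d → ℝ}
    {w s : Fin d} (hne : w ≠ s) (hm : m w = m s)
    (hx : ∀ i, i ≠ s → x' i = x i) (hy : ∀ i, i ≠ w → i ≠ s → y' i = y i)
    (h1 : x' s - y' w = x s) (h2 : y' s = y w + y s) :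
    boundary l (Function.update m w (l s)) x' y' = boundary l m x y := by
  classical
  ext q
  simp only [boundary, Finset.sum_apply, Pi.sub_apply]
  rw [Fintype.sum_eq_add_sum_compl w, Fintype.sum_eq_add_sum_compl w]
  have hs : s ∈ ({w}ᶜ : Finset (Fin d)) := by simpa using hne.symm
  rw [← Finset.add_sum_erase _ _ hs, ← Finset.add_sum_erase _ _ hs]
  have hrest : ∑ i ∈ ({w}ᶜ : Finset (Fin d)).erase s,
      ((Pi.single (l i) (x' i) : Q → ℝ) q -
        (Pi.single (Function.update m w (l s) i) (y' i) : Q → ℝ) q) =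
      ∑ i ∈ ({w}ᶜ : Finset (Fin d)).erase s,
      ((Pi.single (l i) (x i) : Q → ℝ) q - (Pi.single (m i) (y i) : Q → ℝ) q) := by
    refine Finset.sum_congr rfl fun i hi => ?_
    have hi1 : i ≠ s := (Finset.mem_erase.1 hi).1
    have hi2 : i ≠ w := by simpa using (Finset.mem_erase.1 hi).2
    rw [hx i hi1, hy i hi2 hi1, Function.update_of_ne hi2]
  rw [← add_assoc, ← add_assoc]
  congr 1
  · rw [Function.update_self, Function.update_of_ne hne.symm, hx w hne, hm, h2]
    simp only [Pi.single_apply]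
    split_ifs <;> linarith

/-! ### Dimension of the kernel of the boundary operator -/

namespace GIET

variable {d : ℕ} {r : ℕ∞}

noncomputable instance (T : GIET d r) : Fintype (Quot T.VertexGlued) := Fintype.ofFinite _

/-- The top sides form a path through all vertices, so the range of `D` together with one point mass
spans every function on the vertices. Hence `D` has rank at least `κ - 1`, and rank-nullity
concludes. -/
theorem finrank_ker_boundaryMap_add_numSing_le (T : GIET d r) :
    Module.finrank ℝ (LinearMap.ker (boundaryMap T.leftVertex T.rightVertex)) + T.numSing ≤
      d + 1 := by
  classical
  set D := boundaryMap T.leftVertex T.rightVertex with hD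
  let e : Fin (d + 1) → (Quot T.VertexGlued → ℝ) :=
    fun i => Pi.single (Quot.mk _ (Sum.inl i)) 1
  have hDe : ∀ i : Fin d, D (Pi.single (T.permTop i) 1) = e i.castSucc - e i.succ := by
    intro i
    rw [hD, boundaryMap_apply, boundary, Finset.sum_eq_single (T.permTop i)]
    · simp only [Pi.single_eq_same, leftVertex, rightVertex, Equiv.symm_apply_apply, e]
    · intro j _ hj
      simp [Pi.single_eq_of_ne hj]
    · simp
  have hmem : ∀ i, e i ∈ LinearMap.range D ⊔ Submodule.span ℝ {e 0} := by
    intro i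
    induction i using Fin.induction with
    | zero => exact Submodule.mem_sup_right (Submodule.mem_span_singleton_self _)
    | succ i ih =>
      have h1 := Submodule.mem_sup_left (T := Submodule.span ℝ {e 0})
        (LinearMap.mem_range_self D (Pi.single (T.permTop i) 1))
      rw [hDe] at h1
      have h2 := Submodule.sub_mem _ ih h1
      rwa [sub_sub_cancel] at h2
  have htop : LinearMap.range D ⊔ Submodule.span ℝ {e 0} = ⊤ := by
    rw [eq_top_iff]
    intro x _
    rw [← Finset.univ_sum_single x]
    refine Submodule.sum_mem _ fun q _ => ?_
    obtain ⟨i, rfl⟩ := T.exists_inl_eq q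
    have h1 := Submodule.smul_mem _ (x (Quot.mk _ (Sum.inl i))) (hmem i)
    rwa [← Pi.single_smul, smul_eq_mul, mul_one] at h1
  have h1 := Submodule.finrank_add_le_finrank_add_finrank (LinearMap.range D)
    (Submodule.span ℝ {e 0})
  rw [htop, finrank_top, Module.finrank_fintype_fun_eq_card, ← Nat.card_eq_fintype_card] at h1
  have h2 := finrank_span_le_card (R := ℝ) ({e 0} : Set (Quot T.VertexGlued → ℝ))
  have h3 := D.finrank_range_add_finrank_ker
  rw [Set.toFinset_singleton, Finset.card_singleton] at h2
  rw [Module.finrank_fintype_fun_eq_card, Fintype.card_fin] at h3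
  change _ + Nat.card (Quot T.VertexGlued) ≤ _
  omega

/-- By parity the division by two in `genus` is exact, so `d + 1 - κ` is twice the genus with no
rounding loss. -/
theorem finrank_ker_boundaryMap_le (T : GIET d r) :
    Module.finrank ℝ (LinearMap.ker (boundaryMap T.leftVertex T.rightVertex)) ≤
      T.genus + T.genus := by
  have h1 := T.finrank_ker_boundaryMap_add_numSing_le
  obtain ⟨k, hk⟩ := T.even_numSing
  rw [genus]
  omega

end GIET

/-! ### Variation of the logarithmic derivative -/

theorem eVariationOn_add_le (f g : ℝ → ℝ) (s : Set ℝ) :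
    eVariationOn (fun x => f x + g x) s ≤ eVariationOn f s + eVariationOn g s := by
  refine iSup_le fun p => ?_
  obtain ⟨n, u, hu, hus⟩ := p
  refine (Finset.sum_le_sum fun i _ => edist_add_add_le _ _ _ _).trans ?_
  rw [Finset.sum_add_distrib]
  exact add_le_add (eVariationOn.sum_le hu hus) (eVariationOn.sum_le hu hus)

/-- For `r ≥ 2` the positive derivative is `C¹` on a compact interval, so its logarithm is Lipschitz
there. This is the only use of `r ≥ 2`. -/
theorem IsIntervalDiffeo.boundedVariationOn_log_derivWithin {r : ℕ∞} (hr : 2 ≤ r) {g : ℝ → ℝ}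
    {a b c e : ℝ} (hab : a < b) (hg : IsIntervalDiffeo r g a b c e) :
    BoundedVariationOn (fun x => Real.log (derivWithin g (Icc a b) x)) (Icc a b) := by
  have h1 : ContDiffOn ℝ 1 (derivWithin g (Icc a b)) (Icc a b) := by
    refine hg.contDiffOn.derivWithin (uniqueDiffOn_Icc hab) ?_
    have : ((2 : ℕ∞) : WithTop ℕ∞) ≤ (r : WithTop ℕ∞) := by exact_mod_cast hr
    refine le_trans (le_of_eq ?_) this
    norm_num
  have h2 : ContDiffOn ℝ 1 (fun x => Real.log (derivWithin g (Icc a b) x)) (Icc a b) :=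
    h1.log fun x hx => (hg.deriv_pos x hx).ne'
  obtain ⟨K, hK⟩ := h2.exists_lipschitzOnWith one_ne_zero (convex_Icc a b) isCompact_Icc
  have h3 := hK.locallyBoundedVariationOn a b (left_mem_Icc.2 hab.le) (right_mem_Icc.2 hab.le)
  rwa [inter_self] at h3

namespace GIET

variable {d : ℕ} {r : ℕ∞}

/-- The extension of `T` to the closure of the `i`-th top interval. -/
noncomputable def branch (T : GIET d r) (i : Fin d) : ℝ → ℝ := (T.isGIET.branch i).choose

theorem isIntervalDiffeo_branch (T : GIET d r) (i : Fin d) :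
    IsIntervalDiffeo r (T.branch i) (T.topL i) (T.topR i) (T.botL i) (T.botR i) :=
  (T.isGIET.branch i).choose_spec.1

theorem eqOn_branch (T : GIET d r) (i : Fin d) :
    EqOn T.toFun (T.branch i) (Ico (T.topL i) (T.topR i)) :=
  (T.isGIET.branch i).choose_spec.2

/-- The logarithm of the derivative of `T` on the closure of the `i`-th top interval. -/
noncomputable def logDeriv (T : GIET d r) (i : Fin d) (x : ℝ) : ℝ :=
  Real.log (derivWithin (T.branch i) (Icc (T.topL i) (T.topR i)) x)

/-- `branch` is obtained by choice. By continuity any differentiable extension agrees with it on the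
closed interval, so derivatives, also at the end points, may be computed from an explicit formula.
-/
theorem logDeriv_eq_log (T : GIET d r) {i : Fin d} {G G' : ℝ → ℝ}
    (hG : ∀ x ∈ Icc (T.topL i) (T.topR i),
      HasDerivWithinAt G (G' x) (Icc (T.topL i) (T.topR i)) x)
    (h : EqOn T.toFun G (Ico (T.topL i) (T.topR i))) {x : ℝ}
    (hx : x ∈ Icc (T.topL i) (T.topR i)) : T.logDeriv i x = Real.log (G' x) := by
  have hlt := T.isGIET.top.lt i
  have h1 : EqOn (T.branch i) G (Icc (T.topL i) (T.topR i)) := by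
    refine EqOn.of_subset_closure (s := Ico (T.topL i) (T.topR i))
      (fun y hy => (T.eqOn_branch i hy).symm.trans (h hy))
      (T.isIntervalDiffeo_branch i).contDiffOn.continuousOn
      (fun y hy => (hG y hy).continuousWithinAt) Ico_subset_Icc_self ?_
    rw [closure_Ico hlt.ne]
  rw [logDeriv, derivWithin_congr h1 (h1 hx), (hG x hx).derivWithin (uniqueDiffOn_Icc hlt x hx)]

theorem logDeriv_of_eqOn {T T' : GIET d r} {c : ℝ} (hc : 0 < c) {i : Fin d}
    (h1 : ∀ x ∈ Icc (T'.topL i) (T'.topR i), c * x ∈ Icc (T.topL i) (T.topR i))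
    (h2 : ∀ x ∈ Ico (T'.topL i) (T'.topR i), T'.toFun x = T.branch i (c * x) / c) {x : ℝ}
    (hx : x ∈ Icc (T'.topL i) (T'.topR i)) : T'.logDeriv i x = T.logDeriv i (c * x) := by
  refine (T'.logDeriv_eq_log (G := fun x => T.branch i (c * x) / c)
    (G' := fun x => derivWithin (T.branch i) (Icc (T.topL i) (T.topR i)) (c * x))
    (fun y hy => ?_) h2 hx).trans rfl
  have h3 := ((T.isIntervalDiffeo_branch i).hasDeriv (h1 y hy)).comp y
    (((hasDerivAt_id y).const_mul c).hasDerivWithinAt) (fun z hz => h1 z hz)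
  refine (h3.div_const c).congr_deriv ?_
  rw [mul_one, mul_div_cancel_right₀ _ hc.ne']

theorem logDeriv_of_eqOn_comp {T T' : GIET d r} {c : ℝ} (hc : 0 < c) {i j k : Fin d}
    (h1 : ∀ x ∈ Icc (T'.topL i) (T'.topR i), c * x ∈ Icc (T.topL j) (T.topR j))
    (h1' : ∀ x ∈ Icc (T'.topL i) (T'.topR i),
      T.branch j (c * x) ∈ Icc (T.topL k) (T.topR k))
    (h2 : ∀ x ∈ Ico (T'.topL i) (T'.topR i),
      T'.toFun x = T.branch k (T.branch j (c * x)) / c) {x : ℝ}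
    (hx : x ∈ Icc (T'.topL i) (T'.topR i)) :
    T'.logDeriv i x = T.logDeriv j (c * x) + T.logDeriv k (T.branch j (c * x)) := by
  refine (T'.logDeriv_eq_log (G := fun x => T.branch k (T.branch j (c * x)) / c)
    (G' := fun x => derivWithin (T.branch k) (Icc (T.topL k) (T.topR k)) (T.branch j (c * x)) *
      derivWithin (T.branch j) (Icc (T.topL j) (T.topR j)) (c * x))
    (fun y hy => ?_) h2 hx).trans ?_
  · have h3 := ((T.isIntervalDiffeo_branch j).hasDeriv (h1 y hy)).comp y
      (((hasDerivAt_id y).const_mul c).hasDerivWithinAt) (fun z hz => h1 z hz)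
    have h4 := ((T.isIntervalDiffeo_branch k).hasDeriv (h1' y hy)).comp y h3
      (fun z hz => h1' z hz)
    refine (h4.div_const c).congr_deriv ?_
    rw [mul_one, ← mul_assoc, mul_div_cancel_right₀ _ hc.ne']
  · rw [Real.log_mul ((T.isIntervalDiffeo_branch k).deriv_pos _ (h1' x hx)).ne'
      ((T.isIntervalDiffeo_branch j).deriv_pos _ (h1 x hx)).ne', add_comm]
    rfl

/-- The shape slope is a difference quotient of the branch, so the mean value theorem applies. -/
theorem exists_logSlope_eq (T : GIET d r) (i : Fin d) :
    ∃ x ∈ Icc (T.topL i) (T.topR i), T.logSlope i = T.logDeriv i x := by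
  have hlt := T.isGIET.top.lt i
  have hg := T.isIntervalDiffeo_branch i
  obtain ⟨x, hx, hx'⟩ := exists_hasDerivAt_eq_slope (T.branch i)
    (derivWithin (T.branch i) (Icc (T.topL i) (T.topR i))) hlt hg.contDiffOn.continuousOn
    (fun y hy => (hg.hasDeriv (Ioo_subset_Icc_self hy)).hasDerivAt (Icc_mem_nhds hy.1 hy.2))
  refine ⟨x, Ioo_subset_Icc_self hx, ?_⟩
  rw [logDeriv, hx', hg.map_left, hg.map_right]
  rfl

/-- The total variation of the logarithm of the derivative of `T`. -/
noncomputable def totalVariation (T : GIET d r) : ENNReal :=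
  ∑ i, eVariationOn (T.logDeriv i) (Icc (T.topL i) (T.topR i))

theorem totalVariation_ne_top (hr : 2 ≤ r) (T : GIET d r) : T.totalVariation ≠ ⊤ :=
  ENNReal.sum_ne_top.2 fun i _ =>
    (T.isIntervalDiffeo_branch i).boundedVariationOn_log_derivWithin hr (T.isGIET.top.lt i)

theorem abs_logDeriv_sub_le {T : GIET d r} {V : ENNReal} (hV : V ≠ ⊤) (hT : T.totalVariation ≤ V)
    {i : Fin d} {x y : ℝ} (hx : x ∈ Icc (T.topL i) (T.topR i))
    (hy : y ∈ Icc (T.topL i) (T.topR i)) : |T.logDeriv i x - T.logDeriv i y| ≤ V.toReal := by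
  have h1 : edist (T.logDeriv i x) (T.logDeriv i y) ≤ V :=
    (eVariationOn.edist_le _ hx hy).trans ((Finset.single_le_sum
      (f := fun i => eVariationOn (T.logDeriv i) (Icc (T.topL i) (T.topR i)))
      (fun _ _ => zero_le) (Finset.mem_univ i)).trans hT)
  rw [← Real.dist_eq, dist_edist]
  exact ENNReal.toReal_mono hV h1

/-! ### The logarithmic derivative after an elementary step -/

/-- `T'` is obtained from `T` by inducing on `[0, c)` in such a way that the first return to `[0, c)`
takes time two on the top interval `[u, topR (lastBot T))` of the loser `s`, and time one on the other
intervals, the right end point of the interval of the winner `w` being moved to `t`. -/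
structure IsElementaryStep (T T' : GIET d r) (c t u : ℝ) (w s : Fin d) : Prop where
  pos : 0 < c
  ne : w ≠ s
  -- Top wins in the first case, bottom in the second. In both, `c` is the cut point and `u` is its
  -- preimage under the branch with label `lastBot`; at `u` starts the new top interval of the
  -- loser.
  cases : (w = T.lastTop ∧ s = T.lastBot ∧ t = c ∧ u = T.topL T.lastBot) ∨
    (w = T.lastBot ∧ s = T.lastTop ∧ t = u ∧ c = T.topL T.lastTop)
  mem_t : t ∈ Icc (T.topL w) (T.topR w)
  mem_u : u ∈ Icc (T.topL T.lastBot) (T.topR T.lastBot)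
  mem_c : c ∈ Icc (T.topL T.lastTop) (T.topR T.lastTop)
  branch_u : T.branch T.lastBot u = c
  left_ne : ∀ i, i ≠ s → c * T'.topL i = T.topL i
  right_ne : ∀ i, i ≠ w → i ≠ s → c * T'.topR i = T.topR i
  right_winner : c * T'.topR w = t
  left_loser : c * T'.topL s = u
  right_loser : c * T'.topR s = T.topR T.lastBot
  toFun_one : ∀ i, i ≠ s → ∀ x ∈ Ico (T'.topL i) (T'.topR i), T'.toFun x = T.toFun (c * x) / c
  toFun_two : ∀ x ∈ Ico (T'.topL s) (T'.topR s), T'.toFun x = T.toFun (T.toFun (c * x)) / c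

theorem apply_mem_Ico_of_ne_lastBot {T : GIET d r} {i : Fin d}
    (hi : i ≠ T.lastBot) {x : ℝ} (hx : x ∈ Ico (T.topL i) (T.topR i)) :
    T.toFun x ∈ Ico 0 T.cutPoint := by
  have h1 := T.isGIET.mem_bot hx
  exact ⟨(T.isGIET.bot.nonneg_and_le i).1.trans h1.1,
    (h1.2.trans_le (T.isGIET.bot.le_of_last T.botR_lastBot hi)).trans_le (le_max_right _ _)⟩

theorem mem_Ico_of_cutPoint_le {T : GIET d r} {x : ℝ} (h1 : T.cutPoint ≤ x) (h2 : x < 1) :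
    x ∈ Ico (T.topL T.lastTop) (T.topR T.lastTop) :=
  ⟨(le_max_left _ _).trans h1, by rw [topR_lastTop]; exact h2⟩

theorem mul_mem_Ico_of_mem {c p q x : ℝ} (hc : 0 < c) (hx : x ∈ Ico (p / c) (q / c)) :
    c * x ∈ Ico p q :=
  ⟨by have := (div_le_iff₀ hc).1 hx.1; linarith, by have := (lt_div_iff₀ hc).1 hx.2; linarith⟩

theorem isElementaryStep_stepTop {T : GIET d r} (h : T.IsRenormalizable) (hw : T.TopWins) :
    IsElementaryStep T (T.stepTop h hw) T.cutPoint T.cutPoint (T.topL T.lastBot)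
      T.lastTop T.lastBot := by
  have hpos := T.cutPoint_pos h
  have hne := h.1
  have hmem := cutPoint_mem_of_topWins hw
  have hcan : ∀ x, T.cutPoint * (x / T.cutPoint) = x := fun x => mul_div_cancel₀ _ hpos.ne'
  refine ⟨hpos, hne, Or.inl ⟨rfl, rfl, rfl, rfl⟩, Ico_subset_Icc_self hmem,
    left_mem_Icc.2 (T.isGIET.top.lt _).le, Ico_subset_Icc_self hmem, ?_, fun i _ => hcan _,
    fun i hi _ => ?_, ?_, hcan _, ?_, fun i hi x hx => ?_, fun x hx => ?_⟩
  · rw [(T.isIntervalDiffeo_branch _).map_left, cutPoint_of_topWins hw]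
  · simp only [stepTop, Function.update_of_ne hi, hcan]
  · simp only [stepTop, Function.update_self, hcan]
  · simp only [stepTop, Function.update_of_ne hne.symm, hcan]
  · have hx' : T.cutPoint * x ∈ Ico (T.topL i) (T.topR i) := by
      have h1 := mul_mem_Ico_of_mem hpos hx
      refine ⟨h1.1, h1.2.trans_le ?_⟩
      rcases eq_or_ne i T.lastTop with rfl | hi'
      · rw [Function.update_self]; exact hmem.2.le
      · rw [Function.update_of_ne hi']
    change T.normalizedReturn x = _
    rw [normalizedReturn, firstReturn_one (apply_mem_Ico_of_ne_lastBot hi hx')]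
  · have hx' : T.cutPoint * x ∈ Ico (T.topL T.lastBot) (T.topR T.lastBot) := by
      have h1 := mul_mem_Ico_of_mem hpos hx
      rwa [Function.update_of_ne hne.symm] at h1
    have h2 := T.isGIET.mem_bot hx'
    rw [← cutPoint_of_topWins hw, botR_lastBot] at h2
    change T.normalizedReturn x = _
    rw [normalizedReturn, firstReturn_two (fun hn => absurd hn.2 (not_lt.2 h2.1))
      (apply_mem_Ico_of_ne_lastBot hne (mem_Ico_of_cutPoint_le h2.1 h2.2))]

theorem isElementaryStep_stepBot {T : GIET d r} (h : T.IsRenormalizable) (hw : ¬ T.TopWins) :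
    IsElementaryStep T (T.stepBot h hw) T.cutPoint T.cutPreimage T.cutPreimage
      T.lastBot T.lastTop := by
  have hpos := T.cutPoint_pos h
  have hne := h.1
  have hq := cutPreimage_mem hw
  have hfq := apply_cutPreimage hw
  have hcan : ∀ x, T.cutPoint * (x / T.cutPoint) = x := fun x => mul_div_cancel₀ _ hpos.ne'
  have hc := cutPoint_of_not_topWins hw
  refine ⟨hpos, hne.symm, Or.inr ⟨rfl, rfl, rfl, hc⟩, Ico_subset_Icc_self hq,
    Ico_subset_Icc_self hq, ?_, ?_, fun i hi => ?_, fun i hi hi' => ?_, ?_, ?_, ?_,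
    fun i hi x hx => ?_, fun x hx => ?_⟩
  · rw [hc]; exact left_mem_Icc.2 (T.isGIET.top.lt _).le
  · rw [← T.eqOn_branch _ hq, hfq]
  · simp only [stepBot, Function.update_of_ne hi, hcan]
  · simp only [stepBot, Function.update_of_ne hi, Function.update_of_ne hi', hcan]
  · simp only [stepBot, Function.update_self, hcan]
  · simp only [stepBot, Function.update_self, hcan]
  · simp only [stepBot, Function.update_of_ne hne, Function.update_self, hcan]
  · have h1 := mul_mem_Ico_of_mem hpos hx
    change T.normalizedReturn x = _
    rw [normalizedReturn, firstReturn_one]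
    rw [Function.update_of_ne hi] at h1
    rcases eq_or_ne i T.lastBot with rfl | hi'
    · rw [Function.update_self] at h1
      have hx' : T.cutPoint * x ∈ Ico (T.topL T.lastBot) (T.topR T.lastBot) :=
        ⟨h1.1, h1.2.trans hq.2⟩
      refine ⟨(T.isGIET.bot.nonneg_and_le T.lastBot).1.trans (T.isGIET.mem_bot hx').1, ?_⟩
      conv_rhs => rw [← hfq]
      exact T.isGIET.strictMonoOn _ hx' hq h1.2
    · rw [Function.update_of_ne hi', Function.update_of_ne hi] at h1
      exact apply_mem_Ico_of_ne_lastBot hi' h1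
  · have h1 := mul_mem_Ico_of_mem hpos hx
    rw [Function.update_self, Function.update_of_ne hne, Function.update_self] at h1
    have hx' : T.cutPoint * x ∈ Ico (T.topL T.lastBot) (T.topR T.lastBot) :=
      ⟨hq.1.trans h1.1, h1.2⟩
    have h2 := T.isGIET.mem_bot hx'
    rw [botR_lastBot] at h2
    have h3 : T.cutPoint ≤ T.toFun (T.cutPoint * x) := by
      conv_lhs => rw [← hfq]
      exact (T.isGIET.strictMonoOn _).monotoneOn hq hx' h1.1
    change T.normalizedReturn x = _
    rw [normalizedReturn, firstReturn_two (fun hn => absurd hn.2 (not_lt.2 h3))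
      (apply_mem_Ico_of_ne_lastBot hne (mem_Ico_of_cutPoint_le h3 h2.2))]

/-- Packages the two types of step in one form, so that the estimates below are proved once. -/
theorem exists_isElementaryStep {T : GIET d r} (h : T.IsRenormalizable) :
    ∃ c t u, IsElementaryStep T T.rauzyVeech c t u T.winner T.loser := by
  by_cases hw : T.TopWins
  · rw [rauzyVeech_of_topWins h hw, winner, loser, if_pos hw, if_pos hw]
    exact ⟨_, _, _, isElementaryStep_stepTop h hw⟩
  · rw [rauzyVeech_of_not_topWins h hw, winner, loser, if_neg hw, if_neg hw]
    exact ⟨_, _, _, isElementaryStep_stepBot h hw⟩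

/-! ### Variation, boundary and log-slopes under one elementary step -/

namespace IsElementaryStep

variable {T T' : GIET d r} {c t u : ℝ} {w s : Fin d}

theorem mul_mem_Icc (h : IsElementaryStep T T' c t u w s) {i : Fin d} {x : ℝ}
    (hx : x ∈ Icc (T'.topL i) (T'.topR i)) :
    c * x ∈ Icc (c * T'.topL i) (c * T'.topR i) :=
  ⟨mul_le_mul_of_nonneg_left hx.1 h.pos.le, mul_le_mul_of_nonneg_left hx.2 h.pos.le⟩

theorem right_le (h : IsElementaryStep T T' c t u w s) {i : Fin d} (hi : i ≠ s) :
    c * T'.topR i ≤ T.topR i := by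
  rcases eq_or_ne i w with rfl | hi'
  · rw [h.right_winner]; exact h.mem_t.2
  · rw [h.right_ne i hi' hi]

theorem mul_mem_Icc_of_ne (h : IsElementaryStep T T' c t u w s) {i : Fin d} (hi : i ≠ s) {x : ℝ}
    (hx : x ∈ Icc (T'.topL i) (T'.topR i)) : c * x ∈ Icc (T.topL i) (T.topR i) := by
  have h1 := h.mul_mem_Icc hx
  rw [h.left_ne i hi] at h1
  exact ⟨h1.1, h1.2.trans (h.right_le hi)⟩

theorem mul_mem_Icc_loser (h : IsElementaryStep T T' c t u w s) {x : ℝ}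
    (hx : x ∈ Icc (T'.topL s) (T'.topR s)) : c * x ∈ Icc u (T.topR T.lastBot) := by
  have h1 := h.mul_mem_Icc hx
  rwa [h.left_loser, h.right_loser] at h1

theorem mapsTo_branch (h : IsElementaryStep T T' c t u w s) :
    MapsTo (T.branch T.lastBot) (Icc u (T.topR T.lastBot)) (Icc c (T.topR T.lastTop)) := by
  intro x hx
  have hg := T.isIntervalDiffeo_branch T.lastBot
  have hx' : x ∈ Icc (T.topL T.lastBot) (T.topR T.lastBot) := ⟨h.mem_u.1.trans hx.1, hx.2⟩
  refine ⟨?_, ?_⟩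
  · rw [← h.branch_u]
    exact hg.strictMonoOn.monotoneOn h.mem_u hx' hx.1
  · rw [topR_lastTop, ← T.botR_lastBot]
    exact (hg.mapsTo hx').2

theorem branch_mem (h : IsElementaryStep T T' c t u w s) {x : ℝ}
    (hx : x ∈ Icc (T'.topL s) (T'.topR s)) :
    T.branch T.lastBot (c * x) ∈ Icc (T.topL T.lastTop) (T.topR T.lastTop) :=
  Icc_subset_Icc_left h.mem_c.1 (h.mapsTo_branch (h.mul_mem_Icc_loser hx))

theorem logDeriv_of_ne (h : IsElementaryStep T T' c t u w s) {i : Fin d} (hi : i ≠ s) {x : ℝ}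
    (hx : x ∈ Icc (T'.topL i) (T'.topR i)) : T'.logDeriv i x = T.logDeriv i (c * x) := by
  refine logDeriv_of_eqOn h.pos (fun y hy => h.mul_mem_Icc_of_ne hi hy) (fun y hy => ?_) hx
  rw [h.toFun_one i hi y hy, T.eqOn_branch i]
  refine ⟨(h.mul_mem_Icc_of_ne hi (Ico_subset_Icc_self hy)).1, ?_⟩
  exact (mul_lt_mul_of_pos_left hy.2 h.pos).trans_le (h.right_le hi)

/-- Chain rule: whichever side wins, the return orbit from the loser's interval passes first through
the top interval of `lastBot`, then through that of `lastTop`. -/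
theorem logDeriv_loser (h : IsElementaryStep T T' c t u w s) {x : ℝ}
    (hx : x ∈ Icc (T'.topL s) (T'.topR s)) : T'.logDeriv s x =
      T.logDeriv T.lastBot (c * x) + T.logDeriv T.lastTop (T.branch T.lastBot (c * x)) := by
  refine logDeriv_of_eqOn_comp h.pos (fun y hy => ?_) (fun y hy => h.branch_mem hy)
    (fun y hy => ?_) hx
  · exact Icc_subset_Icc_left h.mem_u.1 (h.mul_mem_Icc_loser hy)
  · have h1 : c * y ∈ Ico (T.topL T.lastBot) (T.topR T.lastBot) := by
      refine ⟨h.mem_u.1.trans (h.mul_mem_Icc_loser (Ico_subset_Icc_self hy)).1, ?_⟩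
      rw [← h.right_loser]
      exact mul_lt_mul_of_pos_left hy.2 h.pos
    have h2 : T.branch T.lastBot (c * y) ∈ Ico (T.topL T.lastTop) (T.topR T.lastTop) := by
      refine ⟨(h.branch_mem (Ico_subset_Icc_self hy)).1, ?_⟩
      rw [topR_lastTop, ← T.botR_lastBot]
      exact ((T.isIntervalDiffeo_branch T.lastBot).mem_Ico h1).2
    rw [h.toFun_two y hy, T.eqOn_branch _ h1, T.eqOn_branch _ h2]

theorem monotone_mul (h : IsElementaryStep T T' c t u w s) : Monotone fun x : ℝ => c * x :=
  fun _ _ hxy => mul_le_mul_of_nonneg_left hxy h.pos.le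

theorem eVariationOn_le_of_ne (h : IsElementaryStep T T' c t u w s) {i : Fin d} (hi : i ≠ s) :
    eVariationOn (T'.logDeriv i) (Icc (T'.topL i) (T'.topR i)) ≤
      eVariationOn (T.logDeriv i) (Icc (T.topL i) (c * T'.topR i)) := by
  rw [eVariationOn.congr (g := T.logDeriv i ∘ fun x => c * x)
    (fun x hx => h.logDeriv_of_ne hi hx), ← h.left_ne i hi]
  exact eVariationOn.comp_le_of_monotoneOn _ _ (h.monotone_mul.monotoneOn _)
    (fun x hx => h.mul_mem_Icc hx)

theorem eVariationOn_loser_le (h : IsElementaryStep T T' c t u w s) :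
    eVariationOn (T'.logDeriv s) (Icc (T'.topL s) (T'.topR s)) ≤
      eVariationOn (T.logDeriv T.lastBot) (Icc u (T.topR T.lastBot)) +
      eVariationOn (T.logDeriv T.lastTop) (Icc c (T.topR T.lastTop)) := by
  rw [eVariationOn.congr (g := fun x => T.logDeriv T.lastBot (c * x) +
    T.logDeriv T.lastTop (T.branch T.lastBot (c * x))) (fun x hx => h.logDeriv_loser hx)]
  have hm := (T.isIntervalDiffeo_branch T.lastBot).strictMonoOn.monotoneOn
  refine (eVariationOn_add_le _ _ _).trans (add_le_add ?_ ?_)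
  · exact eVariationOn.comp_le_of_monotoneOn (T.logDeriv T.lastBot) (fun x => c * x)
      (h.monotone_mul.monotoneOn _) (fun x hx => h.mul_mem_Icc_loser hx)
  · refine eVariationOn.comp_le_of_monotoneOn (T.logDeriv T.lastTop)
      (fun x => T.branch T.lastBot (c * x)) (fun x hx y hy hxy => ?_)
      (fun x hx => h.mapsTo_branch (h.mul_mem_Icc_loser hx))
    exact hm (Icc_subset_Icc_left h.mem_u.1 (h.mul_mem_Icc_loser hx))
      (Icc_subset_Icc_left h.mem_u.1 (h.mul_mem_Icc_loser hy)) (h.monotone_mul hxy)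

/-- Monotone changes of variable do not increase variation, and the pieces used by winner and loser
reassemble the intervals of `lastTop` and `lastBot`: one is used whole, the winner's is split at the
point `t`. Variation is additive under this splitting. -/
theorem totalVariation_le (h : IsElementaryStep T T' c t u w s) :
    T'.totalVariation ≤ T.totalVariation := by
  have hsplit : ∀ i, ∀ x ∈ Icc (T.topL i) (T.topR i),
      eVariationOn (T.logDeriv i) (Icc (T.topL i) x) +
        eVariationOn (T.logDeriv i) (Icc x (T.topR i)) =
      eVariationOn (T.logDeriv i) (Icc (T.topL i) (T.topR i)) := by
    intro i x hx
    have := eVariationOn.Icc_add_Icc (T.logDeriv i) hx.1 hx.2 (mem_univ x)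
    simpa only [univ_inter] using this
  have hs : s ∈ ({w}ᶜ : Finset (Fin d)) := by simpa using h.ne.symm
  rw [totalVariation, totalVariation, Fintype.sum_eq_add_sum_compl w,
    Fintype.sum_eq_add_sum_compl w, ← Finset.add_sum_erase _ _ hs, ← Finset.add_sum_erase _ _ hs,
    ← add_assoc, ← add_assoc]
  refine add_le_add ?_ (Finset.sum_le_sum fun i hi => ?_)
  · have h1 := h.eVariationOn_le_of_ne h.ne
    rw [h.right_winner] at h1
    refine (add_le_add h1 h.eVariationOn_loser_le).trans ?_
    have hu := h.mem_u
    have hc := h.mem_c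
    rcases h.cases with ⟨rfl, rfl, rfl, rfl⟩ | ⟨rfl, rfl, rfl, rfl⟩
    · rw [← hsplit _ _ hc, add_assoc, add_comm (eVariationOn (T.logDeriv T.lastBot) _)]
    · rw [← hsplit _ _ hu, add_assoc]
  · have hi1 : i ≠ s := (Finset.mem_erase.1 hi).1
    have hi2 : i ≠ w := by simpa using (Finset.mem_erase.1 hi).2
    have := h.eVariationOn_le_of_ne hi1
    rwa [h.right_ne i hi2 hi1] at this

/-- The values of the logarithmic derivative at the end points have an invariant boundary. -/
theorem boundary_eq (h : IsElementaryStep T T' c t u w s) {Q : Type*} {l m : Fin d → Q}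
    (hl : T.IsLabelling l m) :
    boundary l (Function.update m w (l s)) (fun i => T'.logDeriv i (T'.topL i))
      (fun i => T'.logDeriv i (T'.topR i)) =
    boundary l m (fun i => T.logDeriv i (T.topL i)) (fun i => T.logDeriv i (T.topR i)) := by
  have hl' : ∀ i, T'.topL i ∈ Icc (T'.topL i) (T'.topR i) :=
    fun i => left_mem_Icc.2 (T'.isGIET.top.lt i).le
  have hr' : ∀ i, T'.topR i ∈ Icc (T'.topL i) (T'.topR i) :=
    fun i => right_mem_Icc.2 (T'.isGIET.top.lt i).le
  have h1 := hl.last _ _ T.topR_lastTop T.botR_lastBot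
  have hb : T.branch T.lastBot (T.topR T.lastBot) = T.topR T.lastTop := by
    rw [(T.isIntervalDiffeo_branch _).map_right, botR_lastBot, topR_lastTop]
  refine boundary_update h.ne ?_ (fun i hi => ?_) (fun i hi hi' => ?_) ?_ ?_
  · rcases h.cases with ⟨rfl, rfl, -, -⟩ | ⟨rfl, rfl, -, -⟩
    · exact h1
    · exact h1.symm
  · rw [h.logDeriv_of_ne hi (hl' i), h.left_ne i hi]
  · rw [h.logDeriv_of_ne hi' (hr' i), h.right_ne i hi hi']
  -- The value of the winner's log-derivative at the cut `t` occurs once at the new left end of the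
  -- loser and once at the new right end of the winner; with opposite signs the two cancel.
  · rw [h.logDeriv_loser (hl' s), h.logDeriv_of_ne h.ne (hr' w), h.left_loser, h.right_winner,
      h.branch_u]
    rcases h.cases with ⟨rfl, rfl, rfl, rfl⟩ | ⟨rfl, rfl, rfl, rfl⟩ <;> ring
  · rw [h.logDeriv_loser (hr' s), h.right_loser, hb]
    rcases h.cases with ⟨rfl, rfl, -, -⟩ | ⟨rfl, rfl, -, -⟩ <;> ring

/-- Replacing a value of `log DT` by the log-slope costs at most `V`. The loser's coordinate is a
sum of two such values, hence `2V`. -/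
theorem abs_logSlope_sub_le (h : IsElementaryStep T T' c t u w s) {V : ENNReal} (hV : V ≠ ⊤)
    (hT : T.totalVariation ≤ V) (i : Fin d) :
    |T'.logSlope i - (T.logSlope i + if i = s then T.logSlope w else 0)| ≤
      V.toReal + V.toReal := by
  obtain ⟨y, hy, hy'⟩ := T'.exists_logSlope_eq i
  have key : ∀ j, ∀ x ∈ Icc (T.topL j) (T.topR j), |T.logDeriv j x - T.logSlope j| ≤ V.toReal := by
    intro j x hx
    obtain ⟨z, hz, hz'⟩ := T.exists_logSlope_eq j
    rw [hz']
    exact abs_logDeriv_sub_le hV hT hx hz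
  rcases eq_or_ne i s with rfl | hi
  · have h1 := key _ _ (Icc_subset_Icc_left h.mem_u.1 (h.mul_mem_Icc_loser hy))
    have h2 := key _ _ (h.branch_mem hy)
    have h3 : T.logSlope i + T.logSlope w = T.logSlope T.lastBot + T.logSlope T.lastTop := by
      rcases h.cases with ⟨rfl, rfl, -, -⟩ | ⟨rfl, rfl, -, -⟩ <;> ring
    rw [if_pos rfl, h3, hy', h.logDeriv_loser hy, add_sub_add_comm]
    exact (abs_add_le _ _).trans (add_le_add h1 h2)
  · rw [if_neg hi, add_zero, hy', h.logDeriv_of_ne hi hy]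
    exact (key _ _ (h.mul_mem_Icc_of_ne hi hy)).trans
      (le_add_of_nonneg_right ENNReal.toReal_nonneg)

end IsElementaryStep

end GIET

/-! ### Iteration of the renormalization -/

namespace GIET

variable {d : ℕ} {r : ℕ∞}

theorem IsInfinitelyRenormalizable.iterate {T : GIET d r} (h : T.IsInfinitelyRenormalizable)
    (n : ℕ) : (rauzyVeech^[n] T).IsInfinitelyRenormalizable := fun m => by
  rw [← Function.iterate_add_apply]
  exact h (m + n)

theorem IsRenormalizable.winner_ne_loser {T : GIET d r} (h : T.IsRenormalizable) :
    T.winner ≠ T.loser := by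
  obtain ⟨c, t, u, hs⟩ := exists_isElementaryStep h
  exact hs.ne

theorem stepMatrix_mulVec (T : GIET d r) (x : Fin d → ℝ) (i : Fin d) :
    T.stepMatrix.mulVec x i = x i + if i = T.loser then x T.winner else 0 := by
  rw [stepMatrix, Matrix.add_mulVec, Matrix.one_mulVec, Pi.add_apply, Matrix.single_mulVec]
  simp [Function.update_apply]

theorem det_stepMatrix {T : GIET d r} (h : T.IsRenormalizable) : T.stepMatrix.det = 1 :=
  Matrix.det_transvection_of_ne _ _ h.winner_ne_loser.symm 1

theorem det_cocycle {T : GIET d r} (h : T.IsInfinitelyRenormalizable) (n : ℕ) :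
    (T.cocycle n).det = 1 := by
  induction n with
  | zero => simp [cocycle]
  | succ n ih => rw [cocycle, Matrix.det_mul, det_stepMatrix (h n), ih, one_mul]

theorem norm_stepMatrix_mulVec_le (T : GIET d r) (x : Fin d → ℝ) :
    ‖T.stepMatrix.mulVec x‖ ≤ 2 * ‖x‖ := by
  refine (pi_norm_le_iff_of_nonneg (by positivity)).2 fun i => ?_
  rw [stepMatrix_mulVec, two_mul]
  refine (norm_add_le _ _).trans (add_le_add (norm_le_pi_norm x i) ?_)
  split_ifs
  · exact norm_le_pi_norm x _
  · simp

theorem totalVariation_iterate_le {T : GIET d r} (h : T.IsInfinitelyRenormalizable) (n : ℕ) :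
    (rauzyVeech^[n] T).totalVariation ≤ T.totalVariation := by
  induction n with
  | zero => exact le_rfl
  | succ n ih =>
    obtain ⟨c, t, u, hs⟩ := exists_isElementaryStep (h n)
    rw [Function.iterate_succ_apply']
    exact hs.totalVariation_le.trans ih

/-- The error satisfies `e (n + 1) ≤ 2 * e n + 2V`, since one step matrix at most doubles the sup
norm. Exponential growth in `n` is harmless, as the bound is applied over a single period, with the
same `V` for all renormalizations. -/
theorem norm_logSlope_iterate_sub_le {T : GIET d r} (h : T.IsInfinitelyRenormalizable)
    {V : ENNReal} (hV : V ≠ ⊤) (hT : T.totalVariation ≤ V) (n : ℕ) :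
    ‖logSlope (rauzyVeech^[n] T) - (T.cocycle n).mulVec T.logSlope‖ ≤
      (2 ^ n - 1) * (V.toReal + V.toReal) := by
  induction n with
  | zero => simp [cocycle]
  | succ n ih =>
    set S := rauzyVeech^[n] T with hS
    obtain ⟨c, t, u, hs⟩ := exists_isElementaryStep (h n)
    rw [← hS] at hs
    have hV0 : 0 ≤ V.toReal := ENNReal.toReal_nonneg
    have h1 : ‖logSlope S.rauzyVeech - S.stepMatrix.mulVec S.logSlope‖ ≤
        V.toReal + V.toReal := by
      refine (pi_norm_le_iff_of_nonneg (by positivity)).2 fun i => ?_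
      rw [Pi.sub_apply, stepMatrix_mulVec, Real.norm_eq_abs]
      exact hs.abs_logSlope_sub_le hV ((totalVariation_iterate_le h n).trans hT) i
    rw [Function.iterate_succ_apply', cocycle, ← hS, ← Matrix.mulVec_mulVec]
    have h2 : logSlope S.rauzyVeech - S.stepMatrix.mulVec ((T.cocycle n).mulVec T.logSlope) =
        (logSlope S.rauzyVeech - S.stepMatrix.mulVec S.logSlope) +
        S.stepMatrix.mulVec (S.logSlope - (T.cocycle n).mulVec T.logSlope) := by
      rw [Matrix.mulVec_sub]; abel
    rw [h2]
    refine (norm_add_le _ _).trans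
      ((add_le_add h1 ((norm_stepMatrix_mulVec_le _ _).trans
        (mul_le_mul_of_nonneg_left ih two_pos.le))).trans (le_of_eq ?_))
    ring

theorem boundaryMap_stepMatrix {T : GIET d r} (h : T.IsRenormalizable) {Q : Type*}
    {l m : Fin d → Q} (hl : T.IsLabelling l m) (x : Fin d → ℝ) :
    boundaryMap l (Function.update m T.winner (l T.loser)) (T.stepMatrix.mulVec x) =
      boundaryMap l m x := by
  obtain ⟨c, t, u, hs⟩ := exists_isElementaryStep h
  have h1 := hl.last _ _ T.topR_lastTop T.botR_lastBot
  rw [boundaryMap_apply, boundaryMap_apply]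
  refine boundary_update hs.ne ?_ (fun i hi => ?_) (fun i _ hi => ?_) ?_ ?_
  · rcases hs.cases with ⟨h2, h3, -, -⟩ | ⟨h2, h3, -, -⟩ <;> rw [h2, h3]
    · exact h1
    · exact h1.symm
  · rw [stepMatrix_mulVec, if_neg hi, add_zero]
  · rw [stepMatrix_mulVec, if_neg hi, add_zero]
  · rw [stepMatrix_mulVec, stepMatrix_mulVec, if_pos rfl, if_neg hs.ne]; ring
  · rw [stepMatrix_mulVec, if_pos rfl]; ring

/-- The vertex labelling of `T` can be transported along the renormalization, in such a way that the
boundary of the logarithmic derivative and the boundary of cocycle orbits are invariant. -/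
theorem exists_isLabelling_iterate {T : GIET d r} (h : T.IsInfinitelyRenormalizable) (n : ℕ) :
    ∃ m : Fin d → Quot T.VertexGlued, (rauzyVeech^[n] T).IsLabelling T.leftVertex m ∧
      boundary T.leftVertex m
        (fun i => (rauzyVeech^[n] T).logDeriv i ((rauzyVeech^[n] T).topL i))
        (fun i => (rauzyVeech^[n] T).logDeriv i ((rauzyVeech^[n] T).topR i)) =
      boundary T.leftVertex T.rightVertex (fun i => T.logDeriv i (T.topL i))
        (fun i => T.logDeriv i (T.topR i)) ∧
      ∀ x, boundaryMap T.leftVertex m ((T.cocycle n).mulVec x) =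
        boundaryMap T.leftVertex T.rightVertex x := by
  induction n with
  | zero => exact ⟨T.rightVertex, T.isLabelling_vertex, rfl, fun x => by simp [cocycle]⟩
  | succ n ih =>
    obtain ⟨m, hm, hb, hc⟩ := ih
    obtain ⟨c, t, u, hs⟩ := exists_isElementaryStep (h n)
    rw [Function.iterate_succ_apply']
    refine ⟨_, hm.rauzyVeech (h n), (hs.boundary_eq hm).trans hb, fun x => ?_⟩
    rw [cocycle, ← Matrix.mulVec_mulVec, boundaryMap_stepMatrix (h n) hm, hc]

/-- The boundary of a vector has the same norm for all labellings with the same combinatorial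
data. -/
theorem IsLabelling.norm_boundary_eq {T T' : GIET d r} {m : Fin d → Quot T.VertexGlued}
    (hl : T'.IsLabelling T.leftVertex m) (ht : T'.permTop = T.permTop)
    (hb : T'.permBot = T.permBot) (x y : Fin d → ℝ) :
    ‖boundary T.leftVertex m x y‖ = ‖boundary T.leftVertex T.rightVertex x y‖ := by
  obtain ⟨φ, hφ, h1, h2⟩ := hl.exists_factor ht hb
  -- A surjection of the finite vertex set to itself is a permutation, so the two boundaries differ
  -- by a relabelling of coordinates, which the sup norm ignores.
  let e : Quot T.VertexGlued ≃ Quot T.VertexGlued :=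
    Equiv.ofBijective φ (Finite.injective_iff_bijective.1 (Finite.injective_iff_surjective.2 hφ))
  have h3 : boundary T.leftVertex m x y =
      boundary (e ∘ T.leftVertex) (e ∘ T.rightVertex) x y := by
    congr 1
    · exact funext h1
    · exact funext h2
  rw [h3, boundary_comp_equiv, norm_comp_equiv]

theorem norm_boundary_logSlope_sub_le {T : GIET d r} {V : ENNReal} (hV : V ≠ ⊤)
    (hT : T.totalVariation ≤ V) {Q : Type*} [Fintype Q] (l m : Fin d → Q) :
    ‖boundary l m T.logSlope T.logSlope - boundary l m (fun i => T.logDeriv i (T.topL i))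
      (fun i => T.logDeriv i (T.topR i))‖ ≤ d * (V.toReal + V.toReal) := by
  rw [boundary_sub]
  have key : ∀ i, ∀ x ∈ Icc (T.topL i) (T.topR i), |T.logSlope i - T.logDeriv i x| ≤ V.toReal := by
    intro i x hx
    obtain ⟨z, hz, hz'⟩ := T.exists_logSlope_eq i
    rw [hz']
    exact abs_logDeriv_sub_le hV hT hz hx
  exact norm_boundary_le (fun i => key i _ (left_mem_Icc.2 (T.isGIET.top.lt i).le))
    (fun i => key i _ (right_mem_Icc.2 (T.isGIET.top.lt i).le))

theorem stepMatrix_eq_of_arrow_eq {T T' : GIET d r} (h : T'.arrow = T.arrow) :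
    T'.stepMatrix = T.stepMatrix := by
  classical
  have h1 : T'.permTop = T.permTop := congrArg Prod.fst h
  have h2 : T'.permBot = T.permBot := congrArg (fun x => x.2.1) h
  have h3 : T'.TopWins = T.TopWins := congrArg (fun x => x.2.2) h
  have h4 : T'.lastTop = T.lastTop := by rw [lastTop, h1]; rfl
  have h5 : T'.lastBot = T.lastBot := by rw [lastBot, h2]; rfl
  have h6 : T'.winner = T.winner := by
    rw [winner, winner, h4, h5]; exact if_congr (iff_of_eq h3) rfl rfl
  have h7 : T'.loser = T.loser := by
    rw [loser, loser, h4, h5]; exact if_congr (iff_of_eq h3) rfl rfl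
  rw [stepMatrix, stepMatrix, h6, h7]

theorem cocycle_eq_of_arrow_eq {T T' : GIET d r}
    (h : ∀ n, (rauzyVeech^[n] T').arrow = (rauzyVeech^[n] T).arrow) (n : ℕ) :
    T'.cocycle n = T.cocycle n := by
  induction n with
  | zero => rfl
  | succ n ih => rw [cocycle, cocycle, ih, stepMatrix_eq_of_arrow_eq (h n)]

theorem IsPeriodicType.arrow_iterate {T : GIET d r} {k₀ : ℕ} (h : T.IsPeriodicType k₀)
    (n j : ℕ) : (rauzyVeech^[j] (rauzyVeech^[k₀ * n] T)).arrow = (rauzyVeech^[j] T).arrow := by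
  rw [← Function.iterate_add_apply]
  induction n with
  | zero => rfl
  | succ n ih =>
    rw [← ih, Nat.mul_succ, ← Nat.add_assoc]
    exact h.periodic _

/-- Affine shadowing: the shape log-slope vectors of the renormalizations of a generalized interval
exchange transformation of hyperbolic periodic type stay at bounded distance from an orbit of the
period matrix in its unstable space. -/
theorem IsHyperbolicPeriodicType.exists_affine_shadow (hr : 2 ≤ r) {T : GIET d r} {k₀ : ℕ}
    (hT : T.IsHyperbolicPeriodicType k₀) :
    ∃ v ∈ unstableSpace (T.cocycle k₀), ∃ C : ℝ, ∀ n : ℕ,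
      ‖logSlope ((rauzyVeech^[k₀])^[n] T) - (T.cocycle k₀ ^ n).mulVec v‖ ≤ C := by
  have hper := hT.toIsPeriodicType
  have hren := hper.renormalizable
  set A := T.cocycle k₀ with hA
  have hV := T.totalVariation_ne_top hr
  have hdet : IsUnit A.det := by rw [hA, det_cocycle hren]; exact isUnit_one
  have hAB : A * A⁻¹ = 1 := Matrix.mul_nonsing_inv A hdet
  have hBA : A⁻¹ * A = 1 := Matrix.nonsing_inv_mul A hdet
  have hiter : ∀ n, (rauzyVeech^[k₀])^[n] T = rauzyVeech^[k₀ * n] T := fun n =>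
    (congrFun (Function.iterate_mul rauzyVeech k₀ n) T).symm
  have htop : ∀ n, (rauzyVeech^[k₀ * n] T).permTop = T.permTop := fun n =>
    congrArg Prod.fst (hper.arrow_iterate n 0)
  have hbot : ∀ n, (rauzyVeech^[k₀ * n] T).permBot = T.permBot := fun n =>
    congrArg (fun x => x.2.1) (hper.arrow_iterate n 0)
  -- Over one period the transported boundary is exactly invariant. The transported labels belong to
  -- the original combinatorial data, so they may be replaced by the original labels without
  -- changing the norm.
  have hD : ∀ x, ‖boundaryMap T.leftVertex T.rightVertex (Matrix.toLin' A x)‖ =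
      ‖boundaryMap T.leftVertex T.rightVertex x‖ := by
    intro x
    obtain ⟨m, hm, -, hc⟩ := exists_isLabelling_iterate hren k₀
    have h1 := htop 1
    have h2 := hbot 1
    rw [mul_one] at h1 h2
    rw [← hc x, boundaryMap_apply, boundaryMap_apply, hm.norm_boundary_eq h1 h2]
    rfl
  have hω : ∀ n, ‖logSlope ((rauzyVeech^[k₀])^[n + 1] T) -
      Matrix.toLin' A (logSlope ((rauzyVeech^[k₀])^[n] T))‖ ≤
      (2 ^ k₀ - 1) * (T.totalVariation.toReal + T.totalVariation.toReal) := by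
    intro n
    have h1 := norm_logSlope_iterate_sub_le (hren.iterate (k₀ * n)) hV
      (totalVariation_iterate_le hren _) k₀
    rwa [cocycle_eq_of_arrow_eq (hper.arrow_iterate n), ← hiter,
      ← Function.iterate_succ_apply' (rauzyVeech^[k₀])] at h1
  have hDω : ∀ n, ‖boundaryMap T.leftVertex T.rightVertex
      (logSlope ((rauzyVeech^[k₀])^[n] T))‖ ≤
      d * (T.totalVariation.toReal + T.totalVariation.toReal) +
      ‖boundary T.leftVertex T.rightVertex (fun i => T.logDeriv i (T.topL i))
        (fun i => T.logDeriv i (T.topR i))‖ := by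
    intro n
    rw [hiter]
    obtain ⟨m, hm, hb, -⟩ := exists_isLabelling_iterate hren (k₀ * n)
    rw [boundaryMap_apply, ← hm.norm_boundary_eq (htop n) (hbot n), ← hb]
    have h1 := norm_boundary_logSlope_sub_le hV (totalVariation_iterate_le hren (k₀ * n))
      T.leftVertex m
    have h2 := norm_le_norm_add_norm_sub'
      (boundary T.leftVertex m (rauzyVeech^[k₀ * n] T).logSlope (rauzyVeech^[k₀ * n] T).logSlope)
      (boundary T.leftVertex m
        (fun i => (rauzyVeech^[k₀ * n] T).logDeriv i ((rauzyVeech^[k₀ * n] T).topL i))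
        (fun i => (rauzyVeech^[k₀ * n] T).logDeriv i ((rauzyVeech^[k₀ * n] T).topR i)))
    linarith
  -- Hyperbolicity enters here: the stable and unstable spaces are large enough to fill `ker D`.
  have hdim : Module.finrank ℝ (LinearMap.ker (boundaryMap T.leftVertex T.rightVertex)) ≤
      Module.finrank ℝ (unstableSpace A) + Module.finrank ℝ (stableSpace A) := by
    rw [hT.unstable_dim, hT.stable_dim]
    exact T.finrank_ker_boundaryMap_le
  have hcomm : Commute A A⁻¹ := hAB.trans hBA.symm
  have hlin : ∀ {M N : Matrix (Fin d) (Fin d) ℝ}, M * N = 1 →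
      Matrix.toLin' M * Matrix.toLin' N = 1 := by
    intro M N h
    rw [Module.End.mul_eq_comp, ← Matrix.toLin'_mul, h, Matrix.toLin'_one]
    rfl
  obtain ⟨v, hv, K, hK⟩ := exists_orbit_of_recurrence (f := Matrix.toLin' A)
    (g := Matrix.toLin' A⁻¹) (stableSpace_le_summableOrbits A)
    (unstableSpace_le_summableOrbits hBA) (hlin hBA) (hlin hAB)
    (fun x hx => spectralSubspace_mapsTo (Commute.refl A) hx)
    (fun x hx => spectralSubspace_mapsTo (Commute.refl A) hx)
    (fun x hx => spectralSubspace_mapsTo hcomm hx) hD hdim hω hDω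
  refine ⟨v, hv, K, fun n => ?_⟩
  have h1 := hK n
  rwa [← Matrix.toLin'_pow, Matrix.toLin'_apply] at h1

end GIET

theorem mainTheorem7 {d : ℕ} {r : ℕ∞} (hr : 2 ≤ r) (T : GIET d r) (k₀ : ℕ)
    (hT : T.IsHyperbolicPeriodicType k₀) :
    (∃ C : ℝ, ∀ n : ℕ, ‖GIET.logSlope ((GIET.rauzyVeech^[k₀])^[n] T)‖ ≤ C) ∨
    (∃ v ∈ unstableSpace (T.cocycle k₀), ∃ C : ℝ, ∀ n : ℕ,
      ‖GIET.logSlope ((GIET.rauzyVeech^[k₀])^[n] T) - (T.cocycle k₀ ^ n).mulVec v‖ ≤ C) :=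
  -- No case distinction is needed: the bounded case is covered by `v = 0`.
  Or.inr (hT.exists_affine_shadow hr)
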